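/- For every real number $C$ there is a constant $\tilde\gamma=\tilde\gamma(C)>0$ such that the following holds. Let $(\Omega,\mu)$ be a probability space and let $(\phi_j)_{j\in J}$ be a finite or infinite system of complex-valued measurable functions on $\Omega$ (neither orthogonal nor bounded in general) with $\|\phi_j\|_{L^2(\mu)}=1$ for all $j$, satisfying the $\psi_2(C)$ condition $$\Big\|\sum_{j} a_j\phi_j\Big\|_{\psi_2}\le C\Big(\sum_{j}|a_j|^2\Big)^{1/2}\qquad\text{for all finitely supported complex coefficients } (a_j),$$ where $\|f\|_{\psi_2}=\inf\{t>0:\int_\Omega (e^{|f|^2/t^2}-1)\,d\mu\le 1\}$. Let $(r_j)_{j\in J}$ be independent Rademacher functions (independent random variables, each equal to $\pm1$ with probability $1/2$) on a probability space. Then the system is Rademacher–Sidon with constant $\tilde\gamma$: for complex coefficients $(a_j)$, $$\int \Big\|\sum_{j} r_j(\omega)a_j\phi_j\Big\|_{L^\infty(\mu)}\,d\omega\;\ge\;\tilde\gamma\sum_{j}|a_j| ,$$ and hence the same with the pointwise supremum $\sup_{x\in\Omega}\big|\sum_j r_j(\omega)a_j\phi_j(x)\big|$ in place of the $L^\infty(\mu)$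 norm. This holds for all finite sums, and, when $J$ is countably infinite, for every enumeration of $J$ and all coefficients for which, for almost every $\omega$, the partial sums of the series $\sum_j r_j(\omega)a_j\phi_j$ converge in $\mu$-measure (in particular whenever they converge $\mu$-almost everywhere or in some $L^p(\mu)$); both sides are then elements of $[0,\infty]$. -/

import Mathlib

open MeasureTheory ProbabilityTheory Filter
open scoped ENNReal

noncomputable section

/-- The Young function `ψ₂(x) = exp(|x|²) - 1`. -/
def psiTwo (x : ℝ) : ℝ := Real.exp (|x| ^ 2) - 1

/-- The Orlicz (Luxemburg) norm of `f` associated to a Young function `Φ`: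
the infimum of all `t > 0` with `∫ Φ(|f| / t) dμ ≤ 1` (and `∞` if there is no such `t`). -/
def orliczNorm {Ω : Type*} [MeasurableSpace Ω] (Φ : ℝ → ℝ) (f : Ω → ℂ) (μ : Measure Ω) : ℝ≥0∞ :=
  ⨅ (t : ℝ) (_ : 0 < t) (_ : ∫⁻ x, ENNReal.ofReal (Φ (‖f x‖ / t)) ∂μ ≤ 1), ENNReal.ofReal t

/-- The `ψ₂(C)` condition for a system `φ`: `‖∑ a_j φ_j‖_{ψ₂} ≤ C (∑ |a_j|²)^{1/2}` for all
finite complex linear combinations. -/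
def PsiTwoCondition {Ω ι : Type*} [MeasurableSpace Ω] (C : ℝ) (φ : ι → Ω → ℂ)
    (μ : Measure Ω) : Prop :=
  ∀ (s : Finset ι) (a : ι → ℂ),
    orliczNorm psiTwo (fun x => ∑ j ∈ s, a j * φ j x) μ
      ≤ ENNReal.ofReal (C * Real.sqrt (∑ j ∈ s, ‖a j‖ ^ 2))

/-- `r` is a family of independent Rademacher functions: independent random variables taking
each of the values `1` and `-1` with probability `1/2`. -/
def IsRademacherFamily {Ω' ι : Type*} [MeasurableSpace Ω'] (r : ι → Ω' → ℝ)
    (P : Measure Ω') : Prop :=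
  (∀ j, Measurable (r j)) ∧
  (∀ j, P {ω | r j ω = 1} = 1 / 2 ∧ P {ω | r j ω = -1} = 1 / 2) ∧
  iIndepFun r P

/-- The Rademacher-Sidon inequality with constant `γ`,
`∫ sup_x |∑ r_j(ω) a_j φ_j(x)| dω ≥ γ ∑ |a_j|`, as an inequality in `[0, ∞]`.
The supremum is the essential supremum over `x` (the `L^∞(μ)` norm), which is at most the
pointwise supremum. The first clause is the inequality for finite sums. The second one is the
inequality for infinite series, summed in the order of any enumeration `e` of the system: `S ω` is
the sum of the series `∑ r_j(ω) a_j φ_j`, in the weak sense that the partial sums converge to it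
in `μ`-measure (which follows from convergence `μ`-almost everywhere or in any `L^p(μ)`). -/
def IsRademacherSidon {Ω Ω' ι : Type*} [MeasurableSpace Ω] [MeasurableSpace Ω'] (γ : ℝ)
    (φ : ι → Ω → ℂ) (μ : Measure Ω) (r : ι → Ω' → ℝ) (P : Measure Ω') : Prop :=
  (∀ (s : Finset ι) (a : ι → ℂ),
    ENNReal.ofReal γ * ∑ j ∈ s, ‖a j‖ₑ
      ≤ ∫⁻ ω, eLpNorm (fun x => ∑ j ∈ s, (r j ω : ℂ) * a j * φ j x) ∞ μ ∂P) ∧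
  (∀ (e : ℕ ≃ ι) (a : ι → ℂ) (S : Ω' → Ω → ℂ),
    (∀ᵐ ω ∂P, TendstoInMeasure μ
      (fun (n : ℕ) x => ∑ k ∈ Finset.range n, (r (e k) ω : ℂ) * a (e k) * φ (e k) x)
      atTop (S ω)) →
    ENNReal.ofReal γ * ∑' j, ‖a j‖ₑ ≤ ∫⁻ ω, eLpNorm (S ω) ∞ μ ∂P)

end

open scoped BigOperators Topology

/-! The core is a real, blockwise statement. Let `f j` be subgaussian with second moments bounded
below, `ψ j` their truncations at height `M`, and `K` a block of `N` indices. On a set `B` where `∑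
ψ j ^ 2` is at least `N / 8`, each choice of signs gives a Gibbs measure: normalised Lebesgue-type
density `∏ (1 + β ε_j ψ_j)` with respect to `μ` on `B`. Integration by parts in one factor
(`sign_mul_sub_ratio_eq`) writes `ε_j ∫ f_j dν_ε` as a term of sign mean zero, plus `β` times a
variance-like quantity. Summed over `K` the main part of the latter is of order `N`; the correction
is a linear combination of the means of the `f j` with bounded coefficients. The density of `ν_ε` is
at most `exp (8 β M N)`, so the entropy inequality bounds the second moment of such combinations by
a multiple of `β N ^ 2`, and a small `β` makes the correction harmless. Hence the signed block sum
has Gibbs mean of order `β N` on average over the signs, and a Paley-Zygmund argument passes from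
the Gibbs mean to a subset of `B` whose measure is exponentially small in `N`
(`exists_signs_le_sum_of_block`).

Blocks of geometrically growing size can be treated successively: the exponentially small set left
by one block is still large enough for the next (`exists_sets_le_expect_setMean_blockSum`). Where a
block has too few large functions, one moves to the complement of its good set, and there the block
has sign mean zero because the final set does not depend on its signs. The mean over the final set
is a lower bound for the supremum.

For arbitrary coefficients, order the moduli decreasingly, cut them into blocks of ratio `6`
(`exists_blocks`) and lower them to a constant on each block by the contraction principle
(`signNormSum_mul_le`). The few largest coefficients are bounded individually. Complex functions are
split according to whether the real or the imaginary part, after rotation by the phase of the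
coefficient, carries half of the `L²` norm. Infinite series reduce to partial sums by flipping the
signs of the tail (`lintegral_partialSum_le`). -/

/-- Truncation of a real number at height `M`. -/
noncomputable def truncAt (M y : ℝ) : ℝ := if |y| ≤ M then y else 0

lemma abs_truncAt_le {M : ℝ} (hM : 0 ≤ M) (y : ℝ) : |truncAt M y| ≤ M := by
  unfold truncAt; split_ifs with h <;> simp [*]

/-- Cutting to zero, rather than clamping to `±M`, makes this exact. It lets the untruncated
function appear in the integration by parts while only bounded factors enter the Riesz product. -/
lemma mul_truncAt (M y : ℝ) : y * truncAt M y = truncAt M y ^ 2 := by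
  unfold truncAt; split_ifs <;> ring

lemma measurable_truncAt (M : ℝ) : Measurable (truncAt M) := by
  unfold truncAt
  exact Measurable.ite (measurableSet_le measurable_id.abs measurable_const)
    measurable_id measurable_const

/-! ### Changes of density and moment bounds -/

section Tilt

variable {Ω : Type*} [MeasurableSpace Ω] {μ : Measure Ω}

lemma integrable_exp_of_lintegral_le {F : Ω → ℝ} (hF : Measurable F)
    (h : ∫⁻ x, ENNReal.ofReal (Real.exp (F x)) ∂μ ≤ 2) :
    Integrable (fun x => Real.exp (F x)) μ ∧ ∫ x, Real.exp (F x) ∂μ ≤ 2 := by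
  have hm : AEStronglyMeasurable (fun x => Real.exp (F x)) μ := by
    exact (Real.measurable_exp.comp hF).aestronglyMeasurable
  have hpos : 0 ≤ᵐ[μ] fun x => Real.exp (F x) := ae_of_all _ fun x => (Real.exp_pos _).le
  constructor
  · refine ⟨hm, ?_⟩
    rw [hasFiniteIntegral_iff_ofReal hpos]
    exact h.trans_lt (by simp)
  · rw [integral_eq_lintegral_of_nonneg_ae hpos hm]
    exact (ENNReal.toReal_mono (by simp) h).trans (by simp)

/-- The entropy inequality in the form of a second moment bound after a bounded change of
density. -/
lemma integral_sq_le_of_measure_le {ν : Measure Ω} [IsProbabilityMeasure ν] {R t : ℝ}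
    (hR : 0 < R) (ht : 0 < t) (hν : ν ≤ ENNReal.ofReal R • μ) {F : Ω → ℝ} (hF : Measurable F)
    (h : ∫⁻ x, ENNReal.ofReal (Real.exp (F x ^ 2 / t ^ 2)) ∂μ ≤ 2) :
    Integrable (fun x => F x ^ 2) ν ∧ ∫ x, F x ^ 2 ∂ν ≤ t ^ 2 * Real.log (2 * R) := by
  obtain ⟨hi, h2⟩ := integrable_exp_of_lintegral_le (by fun_prop) h
  have hi' : Integrable (fun x => Real.exp (F x ^ 2 / t ^ 2)) (ENNReal.ofReal R • μ) :=
    hi.smul_measure (by simp)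
  have hiν : Integrable (fun x => Real.exp (F x ^ 2 / t ^ 2)) ν := hi'.mono_measure hν
  have hsq : Integrable (fun x => F x ^ 2 / t ^ 2) ν := by
    refine hiν.mono' (by fun_prop) (ae_of_all _ fun x => ?_)
    rw [Real.norm_of_nonneg (by positivity)]
    linarith [Real.add_one_le_exp (F x ^ 2 / t ^ 2)]
  have hle : ∫ x, Real.exp (F x ^ 2 / t ^ 2) ∂ν ≤ 2 * R := by
    calc _ ≤ ∫ x, Real.exp (F x ^ 2 / t ^ 2) ∂(ENNReal.ofReal R • μ) :=
          integral_mono_measure hν (ae_of_all _ fun x => (Real.exp_pos _).le) hi'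
      _ = R * ∫ x, Real.exp (F x ^ 2 / t ^ 2) ∂μ := by
          rw [integral_smul_measure, ENNReal.toReal_ofReal hR.le, smul_eq_mul]
      _ ≤ _ := by nlinarith
  -- Jensen's inequality for `exp` under `ν` takes the place of the entropy duality: a density
  -- bounded by `R` costs only `log R`.
  have hj : Real.exp (∫ x, F x ^ 2 / t ^ 2 ∂ν) ≤ ∫ x, Real.exp (F x ^ 2 / t ^ 2) ∂ν :=
    convexOn_exp.map_integral_le Real.continuous_exp.continuousOn isClosed_univ
      (ae_of_all _ fun _ => Set.mem_univ _) hsq hiν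
  have hlog : ∫ x, F x ^ 2 / t ^ 2 ∂ν ≤ Real.log (2 * R) := by
    rw [Real.le_log_iff_exp_le (by positivity)]; exact hj.trans hle
  rw [integral_div, div_le_iff₀ (by positivity)] at hlog
  refine ⟨?_, by linarith⟩
  have := hsq.mul_const (t ^ 2)
  refine this.congr (ae_of_all _ fun x => ?_)
  field_simp

/-- The probability measure with density proportional to `w` on the set `B`. -/
noncomputable def tiltOn (μ : Measure Ω) (B : Set Ω) (w : Ω → ℝ) : Measure Ω :=
  (ENNReal.ofReal (∫ x in B, w x ∂μ))⁻¹ •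
    (μ.restrict B).withDensity fun x => ENNReal.ofReal (w x)

variable {B : Set Ω} {w : Ω → ℝ} {lo hi : ℝ}

lemma integrable_of_bounds [IsFiniteMeasure μ] (hw : Measurable w) (hlo : 0 < lo)
    (hb : ∀ x, lo ≤ w x ∧ w x ≤ hi) : Integrable w μ := by
  refine Integrable.of_bound hw.aestronglyMeasurable hi (ae_of_all _ fun x => ?_)
  rw [Real.norm_of_nonneg (hlo.le.trans (hb x).1)]; exact (hb x).2

lemma le_setIntegral_of_bounds [IsFiniteMeasure μ] (hw : Measurable w) (hlo : 0 < lo)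
    (hb : ∀ x, lo ≤ w x ∧ w x ≤ hi) : lo * μ.real B ≤ ∫ x in B, w x ∂μ := by
  calc lo * μ.real B = ∫ x in B, lo ∂μ := by simp [mul_comm]
    _ ≤ _ := integral_mono (by simp) (integrable_of_bounds hw hlo hb) fun x => (hb x).1

lemma integral_tiltOn (hw : Measurable w) (hlo : 0 < lo) (hb : ∀ x, lo ≤ w x ∧ w x ≤ hi)
    (h : Ω → ℝ) :
    ∫ x, h x ∂(tiltOn μ B w) = (∫ x in B, w x * h x ∂μ) / ∫ x in B, w x ∂μ := by
  have h0 : 0 ≤ ∫ x in B, w x ∂μ := integral_nonneg fun x => hlo.le.trans (hb x).1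
  rw [tiltOn, integral_smul_measure, ENNReal.toReal_inv, ENNReal.toReal_ofReal h0,
    integral_withDensity_eq_integral_toReal_smul hw.ennreal_ofReal (by simp), smul_eq_mul,
    div_eq_inv_mul]
  congr 2
  ext x
  rw [ENNReal.toReal_ofReal (hlo.le.trans (hb x).1), smul_eq_mul]

lemma isProbabilityMeasure_tiltOn [IsFiniteMeasure μ] (hw : Measurable w) (hlo : 0 < lo)
    (hb : ∀ x, lo ≤ w x ∧ w x ≤ hi) (hB : 0 < μ.real B) :
    IsProbabilityMeasure (tiltOn μ B w) := by
  have h0 : 0 < ∫ x in B, w x ∂μ := (mul_pos hlo hB).trans_le (le_setIntegral_of_bounds hw hlo hb)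
  constructor
  rw [tiltOn, Measure.smul_apply, withDensity_apply _ MeasurableSet.univ, Measure.restrict_univ,
    ← ofReal_integral_eq_lintegral_ofReal (integrable_of_bounds hw hlo hb)
      (ae_of_all _ fun x => hlo.le.trans (hb x).1), smul_eq_mul]
  exact ENNReal.inv_mul_cancel (by simpa using h0) (by simp)

lemma tiltOn_le [IsFiniteMeasure μ] (hw : Measurable w) (hlo : 0 < lo)
    (hb : ∀ x, lo ≤ w x ∧ w x ≤ hi) (hB : 0 < μ.real B) :
    tiltOn μ B w ≤ ENNReal.ofReal (hi / (lo * μ.real B)) • μ.restrict B := by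
  have h1 := le_setIntegral_of_bounds (μ := μ) (B := B) hw hlo hb
  have h0 : 0 < lo * μ.real B := mul_pos hlo hB
  have h2 : (μ.restrict B).withDensity (fun x => ENNReal.ofReal (w x)) ≤
      ENNReal.ofReal hi • μ.restrict B := by
    rw [← withDensity_const]
    exact withDensity_mono (ae_of_all _ fun x => ENNReal.ofReal_le_ofReal (hb x).2)
  have h3 : (ENNReal.ofReal (∫ x in B, w x ∂μ))⁻¹ ≤ ENNReal.ofReal (lo * μ.real B)⁻¹ := by
    rw [← ENNReal.ofReal_inv_of_pos (h0.trans_le h1)]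
    exact ENNReal.ofReal_le_ofReal (inv_anti₀ h0 h1)
  rw [Measure.le_iff]
  intro s hs
  have h4 := h2 s
  simp only [tiltOn, Measure.smul_apply, smul_eq_mul] at h4 ⊢
  calc _ ≤ ENNReal.ofReal (lo * μ.real B)⁻¹ * (ENNReal.ofReal hi * μ.restrict B s) :=
        mul_le_mul' h3 h4
    _ = _ := by
        rw [← mul_assoc, ← ENNReal.ofReal_mul (by positivity), inv_mul_eq_div]

lemma ae_mem_tiltOn (hB : MeasurableSet B) : ∀ᵐ x ∂(tiltOn μ B w), x ∈ B := by
  refine Measure.ae_smul_measure ?_ _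
  exact (withDensity_absolutelyContinuous _ _).ae_le (ae_restrict_mem hB)

/-- Paley-Zygmund type bound: a random variable exceeds its mean minus `d` with probability at
least `d² / (E X² + d²)`. -/
lemma sq_le_mul_measureReal_sub_mean_le {ν : Measure Ω} [IsProbabilityMeasure ν] {X : Ω → ℝ}
    (hX : Measurable X) (hi : Integrable (fun x => X x ^ 2) ν) {d V : ℝ} (hd : 0 < d)
    (hV : ∫ x, X x ^ 2 ∂ν ≤ V) :
    d ^ 2 ≤ (V + d ^ 2) * ν.real {x | (∫ y, X y ∂ν) - d ≤ X x} := by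
  set e := ∫ y, X y ∂ν with he
  have hXi : Integrable X ν := by
    refine (hi.add (integrable_const 1)).mono' hX.aestronglyMeasurable (ae_of_all _ fun x => ?_)
    simp only [Real.norm_eq_abs, Pi.add_apply]
    rw [abs_le]; constructor <;> nlinarith [sq_nonneg (X x - 1), sq_nonneg (X x + 1)]
  set S := {x | e - d ≤ X x} with hS
  have hSm : MeasurableSet S := measurableSet_le measurable_const hX
  set W := V + d ^ 2 with hW
  have hV0 : 0 ≤ V := (integral_nonneg fun x => sq_nonneg (X x)).trans hV
  have hW0 : 0 < W := by positivity
  -- With `Y = X - e + d`, which has mean `d` and second moment at most `W`, this is `Y ≤ d Y² / (2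
  -- W) + W / (2 d)` on `S` (a completed square); off `S`, `Y` is negative and the square alone
  -- suffices.
  have hpt : ∀ x, X x - e + d ≤ d / (2 * W) * (X x ^ 2 + 2 * (d - e) * X x + (d - e) ^ 2)
      + S.indicator (fun _ => W / (2 * d)) x := by
    intro x
    by_cases hx : x ∈ S
    · rw [Set.indicator_of_mem hx]
      have : d / (2 * W) * (X x ^ 2 + 2 * (d - e) * X x + (d - e) ^ 2) + W / (2 * d)
          - (X x - e + d) = (d * (X x - e + d) - W) ^ 2 / (2 * d * W) := by
        field_simp; ring
      have h2 : 0 ≤ (d * (X x - e + d) - W) ^ 2 / (2 * d * W) := by positivity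
      linarith
    · rw [Set.indicator_of_notMem hx]
      have h1 : X x < e - d := not_le.1 hx
      have : 0 ≤ d / (2 * W) * (X x ^ 2 + 2 * (d - e) * X x + (d - e) ^ 2) := by
        have : X x ^ 2 + 2 * (d - e) * X x + (d - e) ^ 2 = (X x + d - e) ^ 2 := by ring
        rw [this]; positivity
      linarith
  have hq : Integrable (fun x => X x ^ 2 + 2 * (d - e) * X x + (d - e) ^ 2) ν := by fun_prop
  have hind : Integrable (S.indicator (fun _ => W / (2 * d))) ν :=
    (integrable_const _).indicator hSm
  have hint := integral_mono (μ := ν) (by fun_prop) ((hq.const_mul _).add hind) hpt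
  have e1 : ∫ x, (X x - e + d) ∂ν = d := by
    rw [integral_add (by fun_prop) (by fun_prop), integral_sub hXi (by fun_prop)]; simp [← he]
  have e2 : ∫ x, (X x ^ 2 + 2 * (d - e) * X x + (d - e) ^ 2) ∂ν
      = (∫ x, X x ^ 2 ∂ν) + 2 * (d - e) * e + (d - e) ^ 2 := by
    rw [integral_add (by fun_prop) (by fun_prop), integral_add (by fun_prop) (by fun_prop),
      integral_const_mul]; simp [← he]
  rw [e1] at hint
  simp only [Pi.add_apply] at hint
  rw [integral_add (hq.const_mul _) hind, integral_const_mul, e2, integral_indicator_const _ hSm,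
    smul_eq_mul] at hint
  have h5 : (∫ x, X x ^ 2 ∂ν) + 2 * (d - e) * e + (d - e) ^ 2 ≤ W := by nlinarith [sq_nonneg e]
  have h6 : d / (2 * W) * ((∫ x, X x ^ 2 ∂ν) + 2 * (d - e) * e + (d - e) ^ 2) ≤ d / 2 := by
    calc _ ≤ d / (2 * W) * W := by gcongr
      _ = d / 2 := by field_simp
  have h7 : d / 2 ≤ ν.real S * (W / (2 * d)) := by linarith
  have h8 : ν.real S * (W / (2 * d)) = W * ν.real S / (2 * d) := by ring
  rw [h8, le_div_iff₀ (by positivity)] at h7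
  nlinarith

end Tilt

/-! ### Averages over signs -/

section Signs

variable {ι : Type*} [Fintype ι] [DecidableEq ι]

lemma abs_sign_cast (u : ℤˣ) : |((u : ℤ) : ℝ)| = 1 := by
  rcases Int.units_eq_one_or u with h | h <;> simp [h]

lemma sign_cast_mul_self (u : ℤˣ) : ((u : ℤ) : ℝ) * ((u : ℤ) : ℝ) = 1 := by
  rcases Int.units_eq_one_or u with h | h <;> simp [h]

lemma expect_sign_mul_eq_zero (j : ι) (T : (ι → ℤˣ) → ℝ) (hT : DependsOn T {j}ᶜ) :
    𝔼 ε, ((ε j : ℤ) : ℝ) * T ε = 0 := by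
  have h : 𝔼 ε, ((ε j : ℤ) : ℝ) * T ε = 𝔼 ε, -(((ε j : ℤ) : ℝ) * T ε) := by
    refine Fintype.expect_equiv (Equiv.mulRight (Pi.mulSingle j (-1))) _ _ fun ε => ?_
    have : T (ε * Pi.mulSingle j (-1)) = T ε := by
      refine hT fun i hi => ?_
      have hi' : i ≠ j := by simpa using hi
      simp [hi']
    simp [this]
  rw [Finset.expect_neg_distrib] at h
  linarith

/-- Independence of disjoint groups of signs. -/
lemma expect_diag_eq (K U : Set ι) (hKU : Disjoint K U) (h : (ι → ℤˣ) → (ι → ℤˣ) → ℝ)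
    (h1 : ∀ ε', DependsOn (fun ε => h ε ε') K) (h2 : ∀ ε, DependsOn (h ε) U) :
    𝔼 ε, h ε ε = 𝔼 ε, 𝔼 ε', h ε ε' := by
  classical
  -- Exchanging the coordinates outside `K` between two independent copies preserves the uniform law
  -- and turns the off-diagonal value of `h` into a diagonal one.
  let p : (ι → ℤˣ) × (ι → ℤˣ) → (ι → ℤˣ) × (ι → ℤˣ) :=
    fun q => (K.piecewise q.1 q.2, K.piecewise q.2 q.1)
  have hp : Function.Involutive p := by
    intro q
    ext i <;> by_cases hi : i ∈ K <;> simp [p, hi]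
  calc 𝔼 ε, h ε ε = 𝔼 ε, 𝔼 _ε' : ι → ℤˣ, h ε ε := by simp
    _ = 𝔼 q : (ι → ℤˣ) × (ι → ℤˣ), h q.1 q.1 := by
        rw [← Finset.univ_product_univ, Finset.expect_product]
    _ = 𝔼 q : (ι → ℤˣ) × (ι → ℤˣ), h q.1 q.2 := by
        refine (Fintype.expect_equiv hp.toPerm _ _ fun q => ?_).symm
        have e1 : h (K.piecewise q.1 q.2) (K.piecewise q.1 q.2) = h q.1 (K.piecewise q.1 q.2) :=
          h1 _ fun i hi => by simp [hi]
        have e2 : h q.1 (K.piecewise q.1 q.2) = h q.1 q.2 :=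
          h2 _ fun i hi => by
            have : i ∉ K := fun hK => Set.disjoint_left.1 hKU hK hi
            simp [this]
        simp only [Function.Involutive.coe_toPerm, p]
        rw [e1, e2]
    _ = 𝔼 ε, 𝔼 ε', h ε ε' := by rw [← Finset.univ_product_univ, Finset.expect_product]

end Signs

/-- Real systems with `∫ exp (F² / (C² V)) ≤ 2` for `F = ∑ c_j f_j`, `∑ c_j² ≤ V`. -/
def SubgaussianSystem {Ω ι : Type*} [MeasurableSpace Ω] (C : ℝ) (f : ι → Ω → ℝ)
    (μ : Measure Ω) : Prop :=
  ∀ (K : Finset ι) (c : ι → ℝ) (V : ℝ), 0 < V → ∑ j ∈ K, c j ^ 2 ≤ V →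
    ∫⁻ x, ENNReal.ofReal (Real.exp ((∑ j ∈ K, c j * f j x) ^ 2 / (C ^ 2 * V))) ∂μ ≤ 2

/-! ### Riesz products and the estimate for one block -/

section Riesz

variable {Ω ι : Type*}

/-- The Riesz product `∏ (1 + β ε_j ψ_j)` of the truncated functions `ψ_j`. -/
noncomputable def rieszWeight (β M : ℝ) (f : ι → Ω → ℝ) (K : Finset ι) (ε : ι → ℤˣ) (x : Ω) : ℝ :=
  ∏ j ∈ K, (1 + β * ((ε j : ℤ) : ℝ) * truncAt M (f j x))

variable {β M : ℝ} {f : ι → Ω → ℝ} {K : Finset ι}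

lemma abs_mul_sign_mul_truncAt_le (hβ : 0 ≤ β) (hM : 0 ≤ M) (u : ℤˣ) (y : ℝ) :
    |β * ((u : ℤ) : ℝ) * truncAt M y| ≤ β * M := by
  rw [abs_mul, abs_mul, abs_sign_cast, abs_of_nonneg hβ, mul_one]
  exact mul_le_mul_of_nonneg_left (abs_truncAt_le hM y) hβ

lemma rieszWeight_bounds (hβ : 0 ≤ β) (hM : 0 ≤ M) (hβM : β * M ≤ 1 / 2) (ε : ι → ℤˣ) (x : Ω) :
    (1 - β * M) ^ K.card ≤ rieszWeight β M f K ε x ∧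
      rieszWeight β M f K ε x ≤ (1 + β * M) ^ K.card := by
  have h := fun j => abs_le.1 (abs_mul_sign_mul_truncAt_le hβ hM (ε j) (f j x))
  constructor
  · rw [← Finset.prod_const]
    exact Finset.prod_le_prod (fun _ _ => by linarith) fun j _ => by linarith [(h j).1]
  · rw [← Finset.prod_const]
    exact Finset.prod_le_prod (fun j _ => by linarith [(h j).1]) fun j _ => by linarith [(h j).2]

lemma measurable_rieszWeight [MeasurableSpace Ω] (hf : ∀ j, Measurable (f j)) (ε : ι → ℤˣ) :
    Measurable (rieszWeight β M f K ε) := by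
  unfold rieszWeight
  exact Finset.measurable_prod _ fun j _ =>
    ((((measurable_truncAt M).comp (hf j)).const_mul _).const_add _)

lemma dependsOn_rieszWeight {S : Set ι} (hK : (K : Set ι) ⊆ S) :
    DependsOn (rieszWeight β M f K) S := by
  intro ε ε' h
  ext x
  exact Finset.prod_congr rfl fun j hj => by rw [h j (hK hj)]

variable [DecidableEq ι] [MeasurableSpace Ω] {μ : Measure Ω} [IsProbabilityMeasure μ] {B : Set Ω}

/-- Integration by parts for the Gibbs average of one function. -/
lemma sign_mul_sub_ratio_eq (hβ : 0 ≤ β) (hM : 0 ≤ M) (hβM : β * M ≤ 1 / 2)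
    (hf : ∀ j, Measurable (f j)) (hB : 0 < μ.real B) (ε : ι → ℤˣ) {j : ι} (hj : j ∈ K)
    (hfi : Integrable (f j) (tiltOn μ B (rieszWeight β M f K ε))) :
    let ν := tiltOn μ B (rieszWeight β M f K ε)
    let u : Ω → ℝ := fun x => (1 + β * ((ε j : ℤ) : ℝ) * truncAt M (f j x))⁻¹
    let w := rieszWeight β M f (K.erase j) ε
    ((ε j : ℤ) : ℝ) * ∫ x, f j x ∂ν =
      ((ε j : ℤ) : ℝ) * ((∫ x in B, w x * f j x ∂μ) / ∫ x in B, w x ∂μ) +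
      β * ((∫ x, truncAt M (f j x) ^ 2 * u x ∂ν) / (∫ x, u x ∂ν)
        - (∫ x, truncAt M (f j x) * u x ∂ν) / (∫ x, u x ∂ν) * ∫ x, f j x ∂ν) := by
  intro ν u w
  set W := rieszWeight β M f K ε with hW
  have hWm : Measurable W := measurable_rieszWeight hf ε
  have hWb : ∀ x, (1 - β * M) ^ K.card ≤ W x ∧ W x ≤ (1 + β * M) ^ K.card :=
    rieszWeight_bounds hβ hM hβM ε
  have hlo : 0 < (1 - β * M) ^ K.card := pow_pos (by linarith) _
  have hwb : ∀ x, (1 - β * M) ^ (K.erase j).card ≤ w x ∧ w x ≤ (1 + β * M) ^ (K.erase j).card :=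
    rieszWeight_bounds hβ hM hβM ε
  have hlo' : 0 < (1 - β * M) ^ (K.erase j).card := pow_pos (by linarith) _
  have : IsProbabilityMeasure ν := isProbabilityMeasure_tiltOn hWm hlo hWb hB
  have hZ : 0 < ∫ x in B, W x ∂μ := (mul_pos hlo hB).trans_le (le_setIntegral_of_bounds hWm hlo hWb)
  have hz : 0 < ∫ x in B, w x ∂μ := (mul_pos hlo' hB).trans_le
    (le_setIntegral_of_bounds (measurable_rieszWeight hf ε) hlo' hwb)
  set e := ((ε j : ℤ) : ℝ) with he
  have hee : e * e = 1 := sign_cast_mul_self _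
  have habs := fun x => abs_le.1 (abs_mul_sign_mul_truncAt_le hβ hM (ε j) (f j x))
  have hpos : ∀ x, 0 < 1 + β * e * truncAt M (f j x) := fun x => by linarith [(habs x).1]
  have hψm : Measurable fun x => truncAt M (f j x) := (measurable_truncAt M).comp (hf j)
  have hum : Measurable u := ((hψm.const_mul _).const_add _).inv
  have hub : ∀ x, ‖u x‖ ≤ 2 := fun x => by
    rw [Real.norm_of_nonneg (inv_pos.2 (hpos x)).le]
    exact inv_le_of_inv_le₀ (by norm_num) (by linarith [(habs x).1])
  have hux : ∀ x, (1 + β * e * truncAt M (f j x)) * u x = 1 := fun x =>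
    mul_inv_cancel₀ (hpos x).ne'
  have hu1 : ∀ x, u x = 1 - β * e * (truncAt M (f j x) * u x) := fun x => by
    linear_combination hux x
  have hψu : Integrable (fun x => truncAt M (f j x) * u x) ν := by
    refine Integrable.of_bound (hψm.mul hum).aestronglyMeasurable (M * 2) (ae_of_all _ fun x => ?_)
    rw [norm_mul]
    exact mul_le_mul (abs_truncAt_le hM _) (hub x) (norm_nonneg _) hM
  have hψ2u : Integrable (fun x => truncAt M (f j x) ^ 2 * u x) ν := by
    refine Integrable.of_bound ((hψm.pow_const 2).mul hum).aestronglyMeasurable (M ^ 2 * 2)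
      (ae_of_all _ fun x => ?_)
    rw [norm_mul, norm_pow]
    exact mul_le_mul (pow_le_pow_left₀ (norm_nonneg _) (abs_truncAt_le hM _) 2) (hub x)
      (norm_nonneg _) (by positivity)
  -- Multiplying by `u` deletes the factor of index `j`, so ratios of `ν`-integrals against `u` are
  -- averages for the weight without `j`, which do not involve the sign `ε j`.
  have hWw : ∀ x, W x * u x = w x := fun x => by
    simp only [hW, rieszWeight, w]
    rw [← Finset.mul_prod_erase K _ hj]
    linear_combination (∏ i ∈ K.erase j, (1 + β * ((ε i : ℤ) : ℝ) * truncAt M (f i x))) * hux x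
  have iu : ∫ x, u x ∂ν = (∫ x in B, w x ∂μ) / ∫ x in B, W x ∂μ := by
    simp only [ν]
    rw [integral_tiltOn hWm hlo hWb]; simp only [hWw]
  have ifu : ∫ x, u x * f j x ∂ν = (∫ x in B, w x * f j x ∂μ) / ∫ x in B, W x ∂μ := by
    simp only [ν]
    rw [integral_tiltOn hWm hlo hWb]; simp only [← mul_assoc, hWw]
  have iu' : ∫ x, u x ∂ν = 1 - β * e * ∫ x, truncAt M (f j x) * u x ∂ν := by
    rw [integral_congr_ae (ae_of_all _ hu1), integral_sub (by simp) (hψu.const_mul _),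
      integral_const_mul]
    simp
  have ifu' : ∫ x, u x * f j x ∂ν =
      (∫ x, f j x ∂ν) - β * e * ∫ x, truncAt M (f j x) ^ 2 * u x ∂ν := by
    rw [← integral_const_mul, ← integral_sub hfi (hψ2u.const_mul _)]
    refine integral_congr_ae (ae_of_all _ fun x => ?_)
    simp only
    rw [← mul_truncAt]
    conv_lhs => rw [hu1 x]
    ring
  have hu0 : 0 < ∫ x, u x ∂ν := by rw [iu]; positivity
  have hr : (∫ x in B, w x * f j x ∂μ) / ∫ x in B, w x ∂μ =
      (∫ x, u x * f j x ∂ν) / ∫ x, u x ∂ν := by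
    rw [iu, ifu]; field_simp
  rw [hr, ifu']
  set a := ∫ x, f j x ∂ν
  set b := ∫ x, truncAt M (f j x) ^ 2 * u x ∂ν
  set d := ∫ x, truncAt M (f j x) * u x ∂ν
  set y := ∫ x, u x ∂ν with hy
  have hy0 := hu0.ne'
  field_simp
  linear_combination (e * a) * iu' + β * (b - a * d) * hee

omit [DecidableEq ι] [IsProbabilityMeasure μ] in
lemma smul_measure_le_smul {ν : Measure Ω} {a b : ℝ≥0∞} (hab : a ≤ b) (h : μ ≤ ν) :
    a • μ ≤ b • ν := by
  refine Measure.le_iff.2 fun s _ => ?_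
  simpa using mul_le_mul' hab (h s)

lemma sq_integral_le {ν : Measure Ω} [IsProbabilityMeasure ν] {X : Ω → ℝ} (hX : Measurable X)
    (hi : Integrable (fun x => X x ^ 2) ν) :
    Integrable X ν ∧ (∫ x, X x ∂ν) ^ 2 ≤ ∫ x, X x ^ 2 ∂ν := by
  have hXi : Integrable X ν := by
    refine (hi.add (integrable_const 1)).mono' hX.aestronglyMeasurable (ae_of_all _ fun x => ?_)
    simp only [Real.norm_eq_abs, Pi.add_apply]
    rw [abs_le]; constructor <;> nlinarith [sq_nonneg (X x - 1), sq_nonneg (X x + 1)]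
  refine ⟨hXi, ?_⟩
  set e := ∫ x, X x ∂ν with he
  have h0 : 0 ≤ ∫ x, (X x - e) ^ 2 ∂ν := integral_nonneg fun x => sq_nonneg _
  have h1 : ∀ x, (X x - e) ^ 2 = X x ^ 2 - 2 * e * X x + e ^ 2 := fun x => by ring
  simp only [h1] at h0
  rw [integral_add (by fun_prop) (by fun_prop), integral_sub hi (by fun_prop),
    integral_const_mul, ← he] at h0
  simp at h0
  linarith

/-- For every choice of signs a block of functions of a subgaussian system is large on a subset of
`B` whose measure is bounded below; the bound depends on the signs but is large on average. -/
theorem exists_signs_le_sum_of_block [Fintype ι] {C : ℝ} (hC : 0 < C) (hβ : 0 < β) (hM : 0 < M)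
    (hβM : β * M ≤ 1 / 2) (hsmall : 16 * (β * M) * C ^ 2 * M ^ 2 ≤ (1 / 48) ^ 2)
    (hf : ∀ j, Measurable (f j)) (hsub : SubgaussianSystem C f μ)
    (hK1 : 1 ≤ 8 * (β * M) * K.card)
    (hK2 : 16 * (β * M) * C ^ 2 + (β / 96) ^ 2 ≤
      (β / 96) ^ 2 * Real.exp (8 * (β * M) * K.card))
    (hBm : MeasurableSet B) (hB : Real.exp (-(4 * (β * M) * K.card)) ≤ μ.real B)
    (hBK : ∀ x ∈ B, (K.card : ℝ) / 8 ≤ ∑ j ∈ K, truncAt M (f j x) ^ 2) :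
    ∃ m : (ι → ℤˣ) → ℝ, DependsOn m (K : Set ι) ∧ β / 96 * K.card ≤ 𝔼 ε, m ε ∧
      ∀ ε, Real.exp (-(16 * (β * M) * K.card)) ≤
        μ.real {x ∈ B | m ε ≤ ∑ j ∈ K, ((ε j : ℤ) : ℝ) * f j x} := by
  set N : ℝ := (K.card : ℝ) with hN
  have hβM0 : 0 < β * M := mul_pos hβ hM
  have hN0 : 0 < N := by
    by_contra h
    have : N = 0 := le_antisymm (not_lt.1 h) (Nat.cast_nonneg _)
    rw [this] at hK1; norm_num at hK1
  set ν : (ι → ℤˣ) → Measure Ω := fun ε => tiltOn μ B (rieszWeight β M f K ε) with hν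
  set R := Real.exp (8 * (β * M) * N) with hR
  have hB0 : 0 < μ.real B := (Real.exp_pos _).trans_le hB
  have hlo : 0 < (1 - β * M) ^ K.card := pow_pos (by linarith) _
  have hb := fun ε => rieszWeight_bounds (f := f) (K := K) hβ.le hM.le hβM ε
  have hWm := fun ε => measurable_rieszWeight (β := β) (M := M) (K := K) hf ε
  have hprob : ∀ ε, IsProbabilityMeasure (ν ε) := fun ε =>
    isProbabilityMeasure_tiltOn (hWm ε) hlo (hb ε) hB0
  -- Half of the exponent `8 β M N` pays for the oscillation of the Riesz product, through `1 + x ≤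
  -- (1 - x) exp (4 x)` for `0 ≤ x ≤ 1 / 2`, and the other half for the measure of `B`.
  have hratio : (1 + β * M) ^ K.card / ((1 - β * M) ^ K.card * μ.real B) ≤ R := by
    have h1 : (1 + β * M) ^ K.card ≤ (1 - β * M) ^ K.card * Real.exp (4 * (β * M) * N) := by
      have : Real.exp (4 * (β * M) * N) = Real.exp (4 * (β * M)) ^ K.card := by
        rw [← Real.exp_nat_mul]; congr 1; ring
      rw [this, ← mul_pow]
      refine pow_le_pow_left₀ (by positivity) ?_ _
      have := Real.add_one_le_exp (4 * (β * M))
      nlinarith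
    rw [div_le_iff₀ (by positivity)]
    refine h1.trans ?_
    have h2 : R * Real.exp (-(4 * (β * M) * N)) = Real.exp (4 * (β * M) * N) := by
      rw [hR, ← Real.exp_add]; congr 1; ring
    calc _ = R * ((1 - β * M) ^ K.card * Real.exp (-(4 * (β * M) * N))) := by
          rw [← h2]; ring
      _ ≤ _ := by gcongr
  have hνB : ∀ ε, ν ε ≤ ENNReal.ofReal R • μ.restrict B := fun ε =>
    (tiltOn_le (hWm ε) hlo (hb ε) hB0).trans
      (smul_measure_le_smul (ENNReal.ofReal_le_ofReal hratio) le_rfl)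
  have hνμ : ∀ ε, ν ε ≤ ENNReal.ofReal R • μ := fun ε =>
    (hνB ε).trans (smul_measure_le_smul le_rfl Measure.restrict_le_self)
  -- The `log 2` is absorbed by `8 β M N ≥ 1`.
  have hlog : Real.log (2 * R) ≤ 16 * (β * M) * N := by
    rw [Real.log_mul (by norm_num) (Real.exp_pos _).ne', Real.log_exp]
    linarith [Real.log_two_lt_d9]
  have hsq : ∀ ε (c : ι → ℝ) (a : ℝ), 0 < a → (∀ j, |c j| ≤ a) →
      Integrable (fun x => (∑ j ∈ K, c j * f j x) ^ 2) (ν ε) ∧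
      ∫ x, (∑ j ∈ K, c j * f j x) ^ 2 ∂(ν ε) ≤ 16 * (β * M) * C ^ 2 * a ^ 2 * N ^ 2 := by
    intro ε c a ha hc
    have hV : ∑ j ∈ K, c j ^ 2 ≤ a ^ 2 * N := by
      calc _ ≤ ∑ j ∈ K, a ^ 2 := Finset.sum_le_sum fun j _ => sq_le_sq.2 ((hc j).trans (le_abs_self a))
        _ = _ := by simp [hN, mul_comm]
    have h1 := hsub K c (a ^ 2 * N) (by positivity) hV
    have hroot : (C * a * Real.sqrt N) ^ 2 = C ^ 2 * (a ^ 2 * N) := by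
      rw [mul_pow, mul_pow, Real.sq_sqrt hN0.le]; ring
    rw [← hroot] at h1
    have := hprob ε
    obtain ⟨h2, h3⟩ := integral_sq_le_of_measure_le (Real.exp_pos _)
      (by positivity : 0 < C * a * Real.sqrt N) (hνμ ε)
      (Finset.measurable_sum K fun j _ => (hf j).const_mul (c j)) h1
    refine ⟨h2, h3.trans ?_⟩
    rw [hroot]
    calc _ ≤ C ^ 2 * (a ^ 2 * N) * (16 * (β * M) * N) := by gcongr
      _ = _ := by ring
  have hfi : ∀ ε, ∀ j ∈ K, Integrable (f j) (ν ε) := by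
    intro ε j hj
    have := hprob ε
    have h := (hsq ε (Pi.single j 1) 1 one_pos fun i => by
      by_cases hi : i = j
      · subst hi; simp
      · simp [hi]).1
    have e : ∀ x, ∑ i ∈ K, (Pi.single j 1 : ι → ℝ) i * f i x = f j x := fun x => by
      simp [Pi.single_apply, hj]
    simp only [e] at h
    exact (sq_integral_le (hf j) h).1
  -- the lower bound for the Gibbs average of the signed sum
  set T : ι → (ι → ℤˣ) → ℝ := fun j ε =>
    (∫ x in B, rieszWeight β M f (K.erase j) ε x * f j x ∂μ) /
      ∫ x in B, rieszWeight β M f (K.erase j) ε x ∂μ with hT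
  have hTdep : ∀ j, DependsOn (T j) {j}ᶜ := by
    intro j ε ε' h
    have : rieszWeight β M f (K.erase j) ε = rieszWeight β M f (K.erase j) ε' :=
      dependsOn_rieszWeight (by intro i hi; simp at hi; simp [hi.2]) h
    simp only [hT, this]
  have hmain : ∀ ε, β / 48 * N + ∑ j ∈ K, ((ε j : ℤ) : ℝ) * T j ε ≤
      ∑ j ∈ K, ((ε j : ℤ) : ℝ) * ∫ x, f j x ∂(ν ε) := by
    intro ε
    have := hprob ε
    set u : ι → Ω → ℝ := fun j x => (1 + β * ((ε j : ℤ) : ℝ) * truncAt M (f j x))⁻¹ with hu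
    have hkey : ∀ j ∈ K, ((ε j : ℤ) : ℝ) * ∫ x, f j x ∂(ν ε) = ((ε j : ℤ) : ℝ) * T j ε +
      β * ((∫ x, truncAt M (f j x) ^ 2 * u j x ∂(ν ε)) / (∫ x, u j x ∂(ν ε))
        - (∫ x, truncAt M (f j x) * u j x ∂(ν ε)) / (∫ x, u j x ∂(ν ε)) * ∫ x, f j x ∂(ν ε)) :=
      fun j hj => sign_mul_sub_ratio_eq hβ.le hM.le hβM hf hB0 ε hj (hfi ε j hj)
    set c : ι → ℝ := fun j =>
      (∫ x, truncAt M (f j x) * u j x ∂(ν ε)) / (∫ x, u j x ∂(ν ε)) with hc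
    have habs := fun j x => abs_le.1 (abs_mul_sign_mul_truncAt_le hβ.le hM.le (ε j) (f j x))
    have hψm : ∀ j, Measurable fun x => truncAt M (f j x) := fun j =>
      (measurable_truncAt M).comp (hf j)
    have hum : ∀ j, Measurable (u j) := fun j => (((hψm j).const_mul _).const_add _).inv
    have hu2 : ∀ j x, u j x ≤ 2 := fun j x =>
      inv_le_of_inv_le₀ (by norm_num) (by linarith [(habs j x).1])
    have hu1 : ∀ j x, 2 / 3 ≤ u j x := fun j x =>
      (le_inv_comm₀ (by norm_num) (by linarith [(habs j x).1])).2 (by linarith [(habs j x).2])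
    have hui : ∀ j, Integrable (u j) (ν ε) := fun j =>
      integrable_of_bounds (hum j) (by norm_num : (0 : ℝ) < 2 / 3) fun x => ⟨hu1 j x, hu2 j x⟩
    have huI1 : ∀ j, 2 / 3 ≤ ∫ x, u j x ∂(ν ε) := fun j => by
      have := integral_mono (μ := ν ε) (integrable_const (2 / 3 : ℝ)) (hui j) (hu1 j)
      simpa using this
    have huI2 : ∀ j, ∫ x, u j x ∂(ν ε) ≤ 2 := fun j => by
      have := integral_mono (μ := ν ε) (hui j) (integrable_const (2 : ℝ)) (hu2 j)
      simpa using this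
    have hψ2 : ∀ j, Integrable (fun x => truncAt M (f j x) ^ 2) (ν ε) := fun j => by
      refine Integrable.of_bound ((hψm j).pow_const 2).aestronglyMeasurable (M ^ 2)
        (ae_of_all _ fun x => ?_)
      rw [norm_pow]
      exact pow_le_pow_left₀ (norm_nonneg _) (abs_truncAt_le hM.le _) 2
    have hψ2u : ∀ j, Integrable (fun x => truncAt M (f j x) ^ 2 * u j x) (ν ε) := fun j =>
      (hψ2 j).mul_bdd (c := 2) (hum j).aestronglyMeasurable (ae_of_all _ fun x => by
        rw [Real.norm_of_nonneg (by linarith [hu1 j x])]; exact hu2 j x)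
    have hψu : ∀ j, Integrable (fun x => truncAt M (f j x) * u j x) (ν ε) := fun j =>
      (hui j).bdd_mul (c := M) (hψm j).aestronglyMeasurable
        (ae_of_all _ fun x => abs_truncAt_le hM.le _)
    have hcM : ∀ j, |c j| ≤ M := by
      intro j
      have h0 : 0 < ∫ x, u j x ∂(ν ε) := by linarith [huI1 j]
      simp only [hc]
      rw [abs_div, abs_of_pos h0, div_le_iff₀ h0, ← integral_const_mul]
      refine abs_integral_le_integral_abs.trans
        (integral_mono (hψu j).abs ((hui j).const_mul M) fun x => ?_)
      simp only
      rw [abs_mul, abs_of_nonneg (by linarith [hu1 j x] : 0 ≤ u j x)]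
      exact mul_le_mul_of_nonneg_right (abs_truncAt_le hM.le _) (by linarith [hu1 j x])
    -- Since `2 / 3 ≤ u ≤ 2`, weighting by `u` and dividing by its mean loses at most a factor `3`
    -- from the bound `N / 8` valid on `B`.
    have hfirst : N / 24 ≤
        ∑ j ∈ K, (∫ x, truncAt M (f j x) ^ 2 * u j x ∂(ν ε)) / (∫ x, u j x ∂(ν ε)) := by
      have h1 : ∀ j ∈ K, (∫ x, truncAt M (f j x) ^ 2 ∂(ν ε)) / 3 ≤
          (∫ x, truncAt M (f j x) ^ 2 * u j x ∂(ν ε)) / (∫ x, u j x ∂(ν ε)) := by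
        intro j _
        rw [le_div_iff₀ (by linarith [huI1 j])]
        have h2 := integral_mono ((hψ2 j).const_mul (2 / 3)) (hψ2u j) fun x => by
          show 2 / 3 * truncAt M (f j x) ^ 2 ≤ truncAt M (f j x) ^ 2 * u j x
          nlinarith [hu1 j x, sq_nonneg (truncAt M (f j x))]
        rw [integral_const_mul] at h2
        have h3 : 0 ≤ ∫ x, truncAt M (f j x) ^ 2 ∂(ν ε) := integral_nonneg fun x => sq_nonneg _
        nlinarith [huI2 j]
      refine le_trans ?_ (Finset.sum_le_sum h1)
      rw [← Finset.sum_div, ← integral_finsetSum _ fun j _ => hψ2 j]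
      have h4 : N / 8 ≤ ∫ x, ∑ j ∈ K, truncAt M (f j x) ^ 2 ∂(ν ε) := by
        have := integral_mono_ae (μ := ν ε) (integrable_const (N / 8))
          (integrable_finsetSum K fun j _ => hψ2 j)
          ((ae_mem_tiltOn hBm).mono fun x hx => hBK x hx)
        simpa using this
      linarith
    -- The coefficients `c j` are bounded by `M`, so the second moment bound and the smallness of
    -- `β` apply to the whole combination at once; estimating the terms separately would not give
    -- this gain.
    have hsecond : ∑ j ∈ K, c j * ∫ x, f j x ∂(ν ε) ≤ N / 48 := by
      obtain ⟨h1, h2⟩ := hsq ε c M hM hcM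
      have h3 := (sq_integral_le
        (Finset.measurable_sum K fun j _ => (hf j).const_mul (c j)) h1).2
      rw [integral_finsetSum K fun j hj => (hfi ε j hj).const_mul (c j)] at h3
      simp only [integral_const_mul] at h3
      refine le_of_sq_le_sq ?_ (by positivity)
      calc _ ≤ _ := h3
        _ ≤ _ := h2
        _ ≤ (1 / 48) ^ 2 * N ^ 2 := by gcongr
        _ = _ := by ring
    rw [Finset.sum_congr rfl hkey, Finset.sum_add_distrib, ← Finset.mul_sum,
      Finset.sum_sub_distrib]
    have := mul_le_mul_of_nonneg_left (sub_le_sub hfirst hsecond) hβ.le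
    linarith
  have hX : ∀ ε : ι → ℤˣ, Measurable fun x => ∑ j ∈ K, ((ε j : ℤ) : ℝ) * f j x := fun ε =>
    Finset.measurable_sum K fun j _ => (hf j).const_mul _
  -- The Gibbs mean is at least `β N / 48` on average; half of that is given up as the margin `d` in
  -- the Paley-Zygmund bound.
  refine ⟨fun ε => (∑ j ∈ K, ((ε j : ℤ) : ℝ) * ∫ x, f j x ∂(ν ε)) - β / 96 * N, ?_, ?_, ?_⟩
  · intro ε ε' h
    have : ν ε = ν ε' := by
      simp only [hν]
      rw [dependsOn_rieszWeight (K := K) subset_rfl h]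
    simp only [this]
    congr 1
    exact Finset.sum_congr rfl fun j hj => by rw [h j hj]
  · have h1 : 𝔼 ε, (β / 96 * N + ∑ j ∈ K, ((ε j : ℤ) : ℝ) * T j ε) = β / 96 * N := by
      rw [Finset.expect_add_distrib, Finset.expect_sum_comm,
        Finset.sum_eq_zero fun j _ => expect_sign_mul_eq_zero j (T j) (hTdep j)]
      simp
    rw [← h1]
    refine Finset.expect_le_expect fun ε _ => ?_
    linarith [hmain ε]
  · intro ε
    have := hprob ε
    set e := ∫ y, ∑ j ∈ K, ((ε j : ℤ) : ℝ) * f j y ∂(ν ε) with he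
    have hee : ∑ j ∈ K, ((ε j : ℤ) : ℝ) * ∫ x, f j x ∂(ν ε) = e := by
      rw [he, integral_finsetSum K fun j hj => (hfi ε j hj).const_mul _]
      simp only [integral_const_mul]
    simp only [hee]
    obtain ⟨h1, h2⟩ := hsq ε (fun j => ((ε j : ℤ) : ℝ)) 1 one_pos fun j => (abs_sign_cast _).le
    have h3 := sq_le_mul_measureReal_sub_mean_le (hX ε) h1
      (by positivity : 0 < β / 96 * N) h2
    rw [← he] at h3
    set S := {x | e - β / 96 * N ≤ ∑ j ∈ K, ((ε j : ℤ) : ℝ) * f j x} with hS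
    have hSm : MeasurableSet S := measurableSet_le measurable_const (hX ε)
    have h4 : (ν ε).real S ≤ R * μ.real {x ∈ B | x ∈ S} := by
      have h5 := hνB ε S
      rw [Measure.smul_apply, Measure.restrict_apply hSm, smul_eq_mul] at h5
      have h6 := ENNReal.toReal_mono (by finiteness) h5
      rw [ENNReal.toReal_mul, ENNReal.toReal_ofReal (Real.exp_pos _).le, Set.inter_comm] at h6
      exact h6
    have hsp : (β / 96) ^ 2 ≤ (16 * (β * M) * C ^ 2 + (β / 96) ^ 2) * (ν ε).real S := by
      have h7 : (16 * (β * M) * C ^ 2 * 1 ^ 2 * N ^ 2 + (β / 96 * N) ^ 2) * (ν ε).real S =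
          ((16 * (β * M) * C ^ 2 + (β / 96) ^ 2) * (ν ε).real S) * N ^ 2 := by ring
      rw [h7, mul_pow] at h3
      exact le_of_mul_le_mul_right h3 (by positivity)
    -- One factor `R` absorbs the constant in the Paley-Zygmund bound, using that the block is
    -- large; the other converts `ν ε` to `μ`. Hence the exponent `16 β M N`.
    have h8 : (β / 96) ^ 2 ≤ (β / 96) ^ 2 * R * (R * μ.real {x ∈ B | x ∈ S}) :=
      hsp.trans (mul_le_mul hK2 h4 measureReal_nonneg (by positivity))
    have h9 : 1 ≤ R * R * μ.real {x ∈ B | x ∈ S} := by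
      have : 0 < (β / 96) ^ 2 := by positivity
      nlinarith
    have h10 : R * R = (Real.exp (-(16 * (β * M) * N)))⁻¹ := by
      rw [← Real.exp_neg, hR, ← Real.exp_add]; congr 1; ring
    rw [h10, inv_mul_eq_div, one_le_div (Real.exp_pos _)] at h9
    exact h9

end Riesz

/-! ### Successive treatment of growing blocks -/

/-- Constants for which blocks of at least `N₀` functions can be treated. -/
structure BlockConstants (C M β N₀ : ℝ) : Prop where
  C_pos : 0 < C
  beta_pos : 0 < β
  M_pos : 0 < M
  beta_mul_M_le : β * M ≤ 1 / 2
  small : 16 * (β * M) * C ^ 2 * M ^ 2 ≤ (1 / 48) ^ 2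
  one_le : ∀ N, N₀ ≤ N → 1 ≤ 8 * (β * M) * N
  le_exp : ∀ N, N₀ ≤ N → 16 * (β * M) * C ^ 2 + (β / 96) ^ 2 ≤
    (β / 96) ^ 2 * Real.exp (8 * (β * M) * N)

section Blocks

variable {Ω ι : Type*} [MeasurableSpace Ω] {μ : Measure Ω}

/-- The mean value of `F` over the set `D`. -/
noncomputable def setMean (μ : Measure Ω) (D : Set Ω) (F : Ω → ℝ) : ℝ :=
  (∫ x in D, F x ∂μ) / μ.real D

lemma setMean_add {D : Set Ω} {F G : Ω → ℝ} (hF : Integrable F μ) (hG : Integrable G μ) :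
    setMean μ D (fun x => F x + G x) = setMean μ D F + setMean μ D G := by
  rw [setMean, integral_add hF.integrableOn hG.integrableOn, add_div]; rfl

lemma setMean_const_mul {D : Set Ω} (c : ℝ) (F : Ω → ℝ) :
    setMean μ D (fun x => c * F x) = c * setMean μ D F := by
  rw [setMean, integral_const_mul, mul_div_assoc]; rfl

lemma setMean_sum {D : Set Ω} {K : Finset ι} {F : ι → Ω → ℝ} (hF : ∀ j, Integrable (F j) μ) :
    setMean μ D (fun x => ∑ j ∈ K, F j x) = ∑ j ∈ K, setMean μ D (F j) := by
  rw [setMean, integral_finsetSum _ fun j _ => (hF j).integrableOn, Finset.sum_div]; rfl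

lemma le_setMean [IsFiniteMeasure μ] {D : Set Ω} (hD : MeasurableSet D) (hD0 : 0 < μ.real D)
    {F : Ω → ℝ} (hF : Integrable F μ) {c : ℝ} (h : ∀ x ∈ D, c ≤ F x) : c ≤ setMean μ D F := by
  rw [setMean, le_div_iff₀ hD0]
  have := setIntegral_mono_on (μ := μ) (integrable_const c).integrableOn hF.integrableOn hD h
  simpa [mul_comm] using this

/-- The signed sum of a system over finitely many blocks. -/
def blockSum (f : ι → Ω → ℝ) (b : ℕ → ℝ) (J : ℕ → Finset ι) (L : ℕ) (ε : ι → ℤˣ) (x : Ω) : ℝ :=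
  ∑ k ∈ Finset.range L, b k * ∑ j ∈ J k, ((ε j : ℤ) : ℝ) * f j x

variable {f : ι → Ω → ℝ}

lemma integrable_signSum (hfi : ∀ j, Integrable (f j) μ) (K : Finset ι) (ε : ι → ℤˣ) :
    Integrable (fun x => ∑ j ∈ K, ((ε j : ℤ) : ℝ) * f j x) μ :=
  integrable_finsetSum _ fun j _ => (hfi j).const_mul _

lemma integrable_blockSum (hfi : ∀ j, Integrable (f j) μ) (b : ℕ → ℝ) (J : ℕ → Finset ι) (L : ℕ)
    (ε : ι → ℤˣ) : Integrable (blockSum f b J L ε) μ :=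
  integrable_finsetSum _ fun k _ => (integrable_signSum hfi (J k) ε).const_mul _

omit [MeasurableSpace Ω] in
lemma blockSum_succ (b : ℕ → ℝ) (J : ℕ → Finset ι) (L : ℕ) (ε : ι → ℤˣ) :
    blockSum f b J (L + 1) ε = fun x => b 0 * (∑ j ∈ J 0, ((ε j : ℤ) : ℝ) * f j x) +
      blockSum f (fun k => b (k + 1)) (fun k => J (k + 1)) L ε x := by
  ext x; rw [blockSum, Finset.sum_range_succ', add_comm]; rfl

omit [MeasurableSpace Ω] in
lemma dependsOn_blockSum (b : ℕ → ℝ) (J : ℕ → Finset ι) (L : ℕ) :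
    DependsOn (blockSum f b J L) (⋃ k < L, (J k : Set ι)) := by
  intro ε ε' h
  ext x
  refine Finset.sum_congr rfl fun k hk => ?_
  congr 1
  refine Finset.sum_congr rfl fun j hj => ?_
  rw [h j (Set.mem_biUnion (Finset.mem_range.1 hk) hj)]

variable [Fintype ι] [DecidableEq ι] [IsProbabilityMeasure μ] {C M β N₀ : ℝ}

open Classical in
-- Induction on the number of blocks, removing the first and smallest. Counting only blocks good at
-- the point `x`, the lower bound `g` on the total weight survives every step: passing to the good
-- set of a block spends its weight and gains as much in the mean, while passing to the complement
-- spends nothing. The factor `2` in the lower bound for `μ.real B` guarantees that one of the two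
-- sets is large enough. Dependence of `D` on the signs of these blocks alone is what permits
-- averaging out an earlier block.
theorem exists_sets_le_expect_setMean_blockSum (hc : BlockConstants C M β N₀)
    (hf : ∀ j, Measurable (f j)) (hfi : ∀ j, Integrable (f j) μ) (hsub : SubgaussianSystem C f μ)
    (L : ℕ) (J : ℕ → Finset ι) (b : ℕ → ℝ) (B : Set Ω) (g : ℝ) (hb : ∀ k, 0 ≤ b k)
    (hdisj : ∀ k l, k < l → l < L → Disjoint (J k) (J l))
    (hgrow : ∀ k, k + 1 < L → 6 * (J k).card ≤ (J (k + 1)).card)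
    (hBm : MeasurableSet B) (hB0 : 0 < μ.real B)
    (hfirst : 0 < L → N₀ ≤ (J 0).card ∧
      2 * Real.exp (-(4 * (β * M) * (J 0).card)) ≤ μ.real B)
    (hg : ∀ x ∈ B, g ≤ ∑ k ∈ Finset.range L, b k * (J k).card *
      if ((J k).card : ℝ) / 8 ≤ ∑ j ∈ J k, truncAt M (f j x) ^ 2 then 1 else 0) :
    ∃ D : (ι → ℤˣ) → Set Ω, DependsOn D (⋃ k < L, (J k : Set ι)) ∧
      (∀ ε, MeasurableSet (D ε) ∧ D ε ⊆ B ∧ 0 < μ.real (D ε)) ∧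
      β / 96 * g ≤ 𝔼 ε, setMean μ (D ε) (blockSum f b J L ε) := by
  have hβ := hc.beta_pos
  induction L generalizing J b B g with
  | zero =>
    refine ⟨fun _ => B, fun _ _ _ => rfl, fun _ => ⟨hBm, subset_rfl, hB0⟩, ?_⟩
    obtain ⟨x, hx⟩ : B.Nonempty := by
      rw [Set.nonempty_iff_ne_empty]; rintro rfl; simp at hB0
    have := hg x hx
    simp at this
    simp only [blockSum, setMean]
    simp
    exact mul_nonpos_of_nonneg_of_nonpos (by positivity) this
  | succ L ih =>
    obtain ⟨hN0, hBexp⟩ := hfirst L.succ_pos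
    set N : ℝ := ((J 0).card : ℝ) with hN
    have hN1 := hc.one_le N hN0
    set U : Set ι := ⋃ k < L, (J (k + 1) : Set ι) with hU
    have hUnion : (⋃ k < L + 1, (J k : Set ι)) = (J 0 : Set ι) ∪ U := by
      ext i; simp only [hU, Set.mem_iUnion, Set.mem_union]
      constructor
      · rintro ⟨k, hk, hi⟩
        rcases k with _ | k
        · exact Or.inl hi
        · exact Or.inr ⟨k, by omega, hi⟩
      · rintro (hi | ⟨k, hk, hi⟩)
        · exact ⟨0, by omega, hi⟩
        · exact ⟨k + 1, by omega, hi⟩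
    have hJU : Disjoint (J 0 : Set ι) U := by
      simp only [hU, Set.disjoint_iUnion_right]
      intro k hk
      exact Finset.disjoint_coe.2 (hdisj 0 (k + 1) (by omega) (by omega))
    set E : Set Ω := {x | N / 8 ≤ ∑ j ∈ J 0, truncAt M (f j x) ^ 2} with hE
    have hEm : MeasurableSet E := measurableSet_le measurable_const
      (Finset.measurable_sum _ fun j _ => ((measurable_truncAt M).comp (hf j)).pow_const 2)
    -- continuing with the remaining blocks from a subset
    have hih : ∀ (D₀ : Set Ω) (g' : ℝ), MeasurableSet D₀ →
        Real.exp (-(16 * (β * M) * N)) ≤ μ.real D₀ →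
        (∀ x ∈ D₀, g' ≤ ∑ k ∈ Finset.range L, b (k + 1) * (J (k + 1)).card *
          if ((J (k + 1)).card : ℝ) / 8 ≤ ∑ j ∈ J (k + 1), truncAt M (f j x) ^ 2
            then 1 else 0) →
        ∃ D : (ι → ℤˣ) → Set Ω, DependsOn D U ∧
          (∀ ε, MeasurableSet (D ε) ∧ D ε ⊆ D₀ ∧ 0 < μ.real (D ε)) ∧
          β / 96 * g' ≤ 𝔼 ε, setMean μ (D ε)
            (blockSum f (fun k => b (k + 1)) (fun k => J (k + 1)) L ε) := by
      intro D₀ g' hm hexp hg'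
      refine ih (fun k => J (k + 1)) (fun k => b (k + 1)) D₀ g' (fun k => hb _)
        (fun k l hkl hl => hdisj _ _ (by omega) (by omega)) (fun k hk => hgrow _ (by omega)) hm
        ((Real.exp_pos _).trans_le hexp) (fun hL => ?_) hg'
      have h6 : 6 * N ≤ ((J (0 + 1)).card : ℝ) := by
        rw [hN]; exact_mod_cast hgrow 0 (by omega)
      have hβM : 0 < β * M := mul_pos hβ hc.M_pos
      -- The growth factor `6` enters here: `2 exp (-24 β M N) ≤ exp (-16 β M N)` because `8 β M N ≥
      -- 1`.
      refine ⟨by nlinarith, le_trans ?_ hexp⟩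
      have h2 : (2 : ℝ) ≤ Real.exp 1 := by linarith [Real.add_one_le_exp (1 : ℝ)]
      calc 2 * Real.exp (-(4 * (β * M) * ((J (0 + 1)).card : ℝ)))
          ≤ Real.exp 1 * Real.exp (-(4 * (β * M) * (6 * N))) := by gcongr
        _ = Real.exp (1 + -(4 * (β * M) * (6 * N))) := (Real.exp_add _ _).symm
        _ ≤ _ := Real.exp_le_exp.2 (by linarith)
    have hgsucc : ∀ x ∈ B, g ≤ (∑ k ∈ Finset.range L, b (k + 1) * (J (k + 1)).card *
          if ((J (k + 1)).card : ℝ) / 8 ≤ ∑ j ∈ J (k + 1), truncAt M (f j x) ^ 2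
            then 1 else 0) + b 0 * N * if x ∈ E then 1 else 0 := by
      intro x hx
      have := hg x hx
      rw [Finset.sum_range_succ'] at this
      exact this
    have hsplit : μ.real (B ∩ E) + μ.real (B \ E) = μ.real B := measureReal_inter_add_sdiff hEm
    by_cases hcase : Real.exp (-(4 * (β * M) * N)) ≤ μ.real (B ∩ E)
    · obtain ⟨m, hmdep, hmE, hmD⟩ := exists_signs_le_sum_of_block hc.C_pos hβ hc.M_pos
        hc.beta_mul_M_le hc.small hf hsub hN1 (hc.le_exp N hN0) (hBm.inter hEm) hcase
        (fun x hx => hx.2)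
      set D₁ : (ι → ℤˣ) → Set Ω := fun ε =>
        {x ∈ B ∩ E | m ε ≤ ∑ j ∈ J 0, ((ε j : ℤ) : ℝ) * f j x} with hD₁
      have hD₁m : ∀ ε, MeasurableSet (D₁ ε) := fun ε => (hBm.inter hEm).inter
        (measurableSet_le measurable_const
          (Finset.measurable_sum _ fun j _ => (hf j).const_mul _))
      have hD₁dep : DependsOn D₁ (J 0 : Set ι) := by
        intro ε ε' h
        simp only [hD₁]
        rw [hmdep h]
        have : ∀ x, ∑ j ∈ J 0, ((ε j : ℤ) : ℝ) * f j x = ∑ j ∈ J 0, ((ε' j : ℤ) : ℝ) * f j x :=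
          fun x => Finset.sum_congr rfl fun j hj => by rw [h j hj]
        simp only [this]
      -- The continuation is chosen as a function of the set reached, not of the signs, so that it
      -- depends on the first block only through `D₁`. The empty set is a dummy value for sets that
      -- never occur.
      have hch : ∀ D₀ : Set Ω, ∃ D : (ι → ℤˣ) → Set Ω, (∃ ε, D₁ ε = D₀) → (DependsOn D U ∧
          (∀ ε, MeasurableSet (D ε) ∧ D ε ⊆ D₀ ∧ 0 < μ.real (D ε)) ∧
          β / 96 * (g - b 0 * N) ≤ 𝔼 ε, setMean μ (D ε)
            (blockSum f (fun k => b (k + 1)) (fun k => J (k + 1)) L ε)) := by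
        intro D₀
        by_cases h : ∃ ε, D₁ ε = D₀
        · obtain ⟨ε, rfl⟩ := h
          obtain ⟨D, hD⟩ := hih (D₁ ε) (g - b 0 * N) (hD₁m ε) (hmD ε) fun x hx => by
            have := hgsucc x hx.1.1
            rw [if_pos hx.1.2] at this
            linarith
          exact ⟨D, fun _ => hD⟩
        · exact ⟨fun _ => ∅, fun h' => absurd h' h⟩
      choose D₂ hD₂ using hch
      have hD₂' := fun ε => hD₂ (D₁ ε) ⟨ε, rfl⟩
      refine ⟨fun ε => D₂ (D₁ ε) ε, ?_, ?_, ?_⟩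
      · rw [hUnion]
        intro ε ε' h
        have e1 : D₁ ε = D₁ ε' := hD₁dep fun i hi => h i (Or.inl hi)
        simp only [e1]
        exact (hD₂' ε').1 fun i hi => h i (Or.inr hi)
      · intro ε
        obtain ⟨h1, h2, h3⟩ := (hD₂' ε).2.1 ε
        exact ⟨h1, fun x hx => (h2 hx).1.1, h3⟩
      -- The signs of the first block and of the later ones are independent, so the induction
      -- hypothesis may be applied with the first block frozen.
      · have hdiag := expect_diag_eq (J 0 : Set ι) U hJU
          (fun ε ε' => setMean μ (D₂ (D₁ ε) ε')
            (blockSum f (fun k => b (k + 1)) (fun k => J (k + 1)) L ε'))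
          (fun ε' ε₁ ε₂ h => by simp only [hD₁dep h])
          (fun ε ε₁ ε₂ h => by
            have e1 : D₂ (D₁ ε) ε₁ = D₂ (D₁ ε) ε₂ := (hD₂' ε).1 h
            have e2 := dependsOn_blockSum (f := f) (fun k => b (k + 1)) (fun k => J (k + 1)) L h
            simp only [e1, e2])
        have hlow : ∀ ε, b 0 * m ε + setMean μ (D₂ (D₁ ε) ε)
            (blockSum f (fun k => b (k + 1)) (fun k => J (k + 1)) L ε) ≤
            setMean μ (D₂ (D₁ ε) ε) (blockSum f b J (L + 1) ε) := by
          intro ε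
          obtain ⟨h1, h2, h3⟩ := (hD₂' ε).2.1 ε
          rw [blockSum_succ, setMean_add ((integrable_signSum hfi _ ε).const_mul _)
            (integrable_blockSum hfi _ _ _ _), setMean_const_mul]
          gcongr
          · exact hb 0
          · exact le_setMean h1 h3 (integrable_signSum hfi _ ε) fun x hx => (h2 hx).2
        calc β / 96 * g = b 0 * (β / 96 * N) + β / 96 * (g - b 0 * N) := by ring
          _ ≤ b 0 * (𝔼 ε, m ε) + 𝔼 ε, 𝔼 ε', setMean μ (D₂ (D₁ ε) ε')
            (blockSum f (fun k => b (k + 1)) (fun k => J (k + 1)) L ε') := by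
              gcongr
              · exact hb 0
              · exact Finset.le_expect Finset.univ_nonempty
                  fun ε _ => (hD₂' ε).2.2
          _ = 𝔼 ε, (b 0 * m ε + setMean μ (D₂ (D₁ ε) ε)
            (blockSum f (fun k => b (k + 1)) (fun k => J (k + 1)) L ε)) := by
              rw [← hdiag, Finset.mul_expect, Finset.expect_add_distrib]
          _ ≤ _ := Finset.expect_le_expect fun ε _ => hlow ε
    · have hdiff : Real.exp (-(16 * (β * M) * N)) ≤ μ.real (B \ E) := by
        have h1 : Real.exp (-(16 * (β * M) * N)) ≤ Real.exp (-(4 * (β * M) * N)) :=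
          Real.exp_le_exp.2 (by linarith)
        linarith
      obtain ⟨D, hDdep, hD, hDE⟩ := hih (B \ E) g (hBm.diff hEm) hdiff fun x hx => by
        have := hgsucc x hx.1
        rw [if_neg hx.2] at this
        linarith
      refine ⟨D, ?_, fun ε => ⟨(hD ε).1, (hD ε).2.1.trans Set.sdiff_subset, (hD ε).2.2⟩, ?_⟩
      · rw [hUnion]
        exact fun ε ε' h => hDdep fun i hi => h i (Or.inr hi)
      · refine hDE.trans (le_of_eq ?_)
        have h1 : ∀ ε, setMean μ (D ε) (blockSum f b J (L + 1) ε) =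
            b 0 * (∑ j ∈ J 0, ((ε j : ℤ) : ℝ) * setMean μ (D ε) (f j)) + setMean μ (D ε)
              (blockSum f (fun k => b (k + 1)) (fun k => J (k + 1)) L ε) := by
          intro ε
          rw [blockSum_succ, setMean_add ((integrable_signSum hfi _ ε).const_mul _)
            (integrable_blockSum hfi _ _ _ _), setMean_const_mul,
            setMean_sum fun j => (hfi j).const_mul _]
          simp only [setMean_const_mul]
        simp only [h1]
        rw [Finset.expect_add_distrib, ← Finset.mul_expect, Finset.expect_sum_comm,
          Finset.sum_eq_zero, mul_zero, zero_add]
        intro j hj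
        -- `D` was built from the later blocks only, so the skipped block contributes nothing on
        -- average.
        refine expect_sign_mul_eq_zero j _ fun ε ε' h => ?_
        have : D ε = D ε' := hDdep fun i hi => h i fun hij => by
          rw [Set.mem_singleton_iff] at hij
          exact Set.disjoint_left.1 hJU hj (hij ▸ hi)
        rw [this]

end Blocks

/-! ### The set from which the block construction starts -/

section

variable {Ω ι : Type*} [MeasurableSpace Ω] {μ : Measure Ω} [IsProbabilityMeasure μ]

/-- A function bounded by `S` with mean at least `p S` is at least `p S / 2` on a set of measure
`p / 2`. -/
lemma half_le_measureReal_of_le_integral {G : Ω → ℝ} (hG : Measurable G) {S p : ℝ}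
    (hp : p ≤ 1) (hS : 0 ≤ S) (h0 : ∀ x, 0 ≤ G x) (h1 : ∀ x, G x ≤ S)
    (hint : p * S ≤ ∫ x, G x ∂μ) : p / 2 ≤ μ.real {x | p * S / 2 ≤ G x} := by
  set B := {x | p * S / 2 ≤ G x} with hB
  have hBm : MeasurableSet B := measurableSet_le measurable_const hG
  rcases hS.eq_or_lt with rfl | hS
  · have : B = Set.univ := by
      ext x; simpa [hB] using h0 x
    rw [this, probReal_univ]; linarith
  have hpt : ∀ x, G x ≤ p * S / 2 + B.indicator (fun _ => S - p * S / 2) x := by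
    intro x
    by_cases hx : x ∈ B
    · rw [Set.indicator_of_mem hx]; linarith [h1 x]
    · rw [Set.indicator_of_notMem hx]; linarith [not_le.1 (show ¬ p * S / 2 ≤ G x from hx)]
  have hi : Integrable (B.indicator (fun _ => S - p * S / 2)) μ :=
    (integrable_const _).indicator hBm
  have hGi : Integrable G μ := Integrable.of_bound hG.aestronglyMeasurable S
    (ae_of_all _ fun x => by rw [Real.norm_of_nonneg (h0 x)]; exact h1 x)
  have h2 := integral_mono hGi ((integrable_const _).add hi) hpt
  simp only [Pi.add_apply] at h2
  rw [integral_add (integrable_const _) hi, integral_indicator_const _ hBm] at h2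
  simp only [integral_const, probReal_univ, smul_eq_mul, one_mul] at h2
  by_contra hlt
  have hlt' := not_le.1 hlt
  have hB0 : 0 ≤ μ.real B := measureReal_nonneg
  have hp0 : 0 < p := by linarith
  have h3 : μ.real B * (S - p * S / 2) ≤ μ.real B * S := by
    apply mul_le_mul_of_nonneg_left _ hB0
    have : 0 ≤ p * S := by positivity
    linarith
  have h4 : μ.real B * S < p / 2 * S := by gcongr
  linarith

variable {f : ι → Ω → ℝ} {C M β N₀ : ℝ}

lemma quarter_le_integral_truncAt_sq {C : ℝ} (hC : 0 < C) {F : Ω → ℝ} (hF : Measurable F)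
    (hexp : ∫⁻ x, ENNReal.ofReal (Real.exp (F x ^ 2 / C ^ 2)) ∂μ ≤ 2)
    (h2 : 1 / 2 ≤ ∫ x, F x ^ 2 ∂μ) :
    1 / 4 ≤ ∫ x, truncAt (4 * C ^ 2) (F x) ^ 2 ∂μ := by
  obtain ⟨hi, hle⟩ := integrable_exp_of_lintegral_le (by fun_prop) hexp
  have htm : Measurable fun x => truncAt (4 * C ^ 2) (F x) := (measurable_truncAt _).comp hF
  have hti : Integrable (fun x => truncAt (4 * C ^ 2) (F x) ^ 2) μ := by
    refine Integrable.of_bound (htm.pow_const 2).aestronglyMeasurable ((4 * C ^ 2) ^ 2)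
      (ae_of_all _ fun x => ?_)
    rw [norm_pow]
    exact pow_le_pow_left₀ (norm_nonneg _) (abs_truncAt_le (by positivity) _) 2
  -- Above the truncation height `4 C²`, `y = F² / C²` is at least `16 C²`, so `F² = C² y ≤ y² / 16
  -- ≤ exp y / 8`. The exponential integral is at most `2`, so truncation loses at most `1 / 4`.
  have hpt : ∀ x, F x ^ 2 ≤
      truncAt (4 * C ^ 2) (F x) ^ 2 + 1 / 8 * Real.exp (F x ^ 2 / C ^ 2) := by
    intro x
    unfold truncAt
    split_ifs with h
    · linarith [Real.exp_pos (F x ^ 2 / C ^ 2)]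
    · have h3 : (4 * C ^ 2) ^ 2 ≤ F x ^ 2 := by
        rw [← sq_abs (F x)]; exact pow_le_pow_left₀ (by positivity) (not_le.1 h).le 2
      set y := F x ^ 2 / C ^ 2 with hy
      have hy0 : 0 ≤ y := by positivity
      have hFy : F x ^ 2 = C ^ 2 * y := by rw [hy]; field_simp
      have h4 : y ^ 2 / 2 ≤ Real.exp y := by
        have := Real.quadratic_le_exp_of_nonneg hy0
        linarith
      have h5 : 16 * C ^ 2 ≤ y := by
        rw [hy, le_div_iff₀ (by positivity)]; linarith
      rw [hFy]
      nlinarith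
  have hFi : Integrable (fun x => F x ^ 2) μ := by
    refine (hti.add (hi.const_mul (1 / 8))).mono' (by fun_prop) (ae_of_all _ fun x => ?_)
    rw [Real.norm_of_nonneg (sq_nonneg _)]; exact hpt x
  have h3 := integral_mono hFi (hti.add (hi.const_mul (1 / 8))) hpt
  simp only [Pi.add_apply] at h3
  rw [integral_add hti (hi.const_mul _), integral_const_mul] at h3
  linarith

lemma le_measureReal_sum_truncAt_sq (hM : 0 < M) (hf : ∀ j, Measurable (f j)) (K : Finset ι)
    (h : ∀ j ∈ K, 1 / 4 ≤ ∫ x, truncAt M (f j x) ^ 2 ∂μ) (hK : K.Nonempty) :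
    1 / (8 * M ^ 2) ≤ μ.real {x | (K.card : ℝ) / 8 ≤ ∑ j ∈ K, truncAt M (f j x) ^ 2} := by
  have hK0 : (0 : ℝ) < K.card := by exact_mod_cast hK.card_pos
  have htm : ∀ j, Measurable fun x => truncAt M (f j x) ^ 2 := fun j =>
    ((measurable_truncAt M).comp (hf j)).pow_const 2
  have hb : ∀ j x, truncAt M (f j x) ^ 2 ≤ M ^ 2 := fun j x => by
    rw [← sq_abs]; exact pow_le_pow_left₀ (abs_nonneg _) (abs_truncAt_le hM.le _) 2
  have hti : ∀ j, Integrable (fun x => truncAt M (f j x) ^ 2) μ := fun j =>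
    Integrable.of_bound (htm j).aestronglyMeasurable (M ^ 2) (ae_of_all _ fun x => by
      rw [Real.norm_of_nonneg (sq_nonneg _)]; exact hb j x)
  set E := {x | (K.card : ℝ) / 8 ≤ ∑ j ∈ K, truncAt M (f j x) ^ 2} with hE
  have hEm : MeasurableSet E := measurableSet_le measurable_const
    (Finset.measurable_sum _ fun j _ => htm j)
  have hpt : ∀ x, ∑ j ∈ K, truncAt M (f j x) ^ 2 ≤
      K.card / 8 + E.indicator (fun _ => (K.card : ℝ) * M ^ 2) x := by
    intro x
    by_cases hx : x ∈ E
    · rw [Set.indicator_of_mem hx]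
      have : ∑ j ∈ K, truncAt M (f j x) ^ 2 ≤ K.card * M ^ 2 := by
        simpa using Finset.sum_le_sum fun j (_ : j ∈ K) => hb j x
      linarith
    · rw [Set.indicator_of_notMem hx]
      have : ¬ (K.card : ℝ) / 8 ≤ ∑ j ∈ K, truncAt M (f j x) ^ 2 := hx
      linarith
  have hi : Integrable (E.indicator (fun _ => (K.card : ℝ) * M ^ 2)) μ :=
    (integrable_const _).indicator hEm
  have h2 := integral_mono (integrable_finsetSum K fun j _ => hti j)
    ((integrable_const _).add hi) hpt
  simp only [Pi.add_apply] at h2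
  rw [integral_add (integrable_const _) hi, integral_indicator_const _ hEm,
    integral_finsetSum K fun j _ => hti j] at h2
  simp only [integral_const, probReal_univ, smul_eq_mul, one_mul] at h2
  have h3 : (K.card : ℝ) * (1 / 4) ≤ ∑ j ∈ K, ∫ x, truncAt M (f j x) ^ 2 ∂μ := by
    simpa using Finset.sum_le_sum h
  rw [div_le_iff₀ (by positivity)]
  have h4 : (K.card : ℝ) * 1 ≤ K.card * (μ.real E * (8 * M ^ 2)) := by linarith
  exact le_of_mul_le_mul_left h4 hK0

open Classical in
/-- The lower bound for block sums on the whole space. -/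
theorem exists_sets_mul_sum_le_expect_setMean [Fintype ι] [DecidableEq ι]
    (hc : BlockConstants C M β N₀) (hM1 : 1 ≤ M)
    (hN₀ : ∀ N : ℝ, N₀ ≤ N → 2 * Real.exp (-(4 * (β * M) * N)) ≤ 1 / (8 * M ^ 2) / 2)
    (hf : ∀ j, Measurable (f j)) (hfi : ∀ j, Integrable (f j) μ) (hsub : SubgaussianSystem C f μ)
    (L : ℕ) (J : ℕ → Finset ι) (b : ℕ → ℝ) (hb : ∀ k, 0 ≤ b k)
    (hdisj : ∀ k l, k < l → l < L → Disjoint (J k) (J l))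
    (hgrow : ∀ k, k + 1 < L → 6 * (J k).card ≤ (J (k + 1)).card)
    (hfirst : 0 < L → N₀ ≤ (J 0).card)
    (h4 : ∀ k < L, ∀ j ∈ J k, 1 / 4 ≤ ∫ x, truncAt M (f j x) ^ 2 ∂μ) :
    ∃ D : (ι → ℤˣ) → Set Ω, (∀ ε, MeasurableSet (D ε) ∧ 0 < μ.real (D ε)) ∧
      β / 96 * (1 / (8 * M ^ 2) / 2) * ∑ k ∈ Finset.range L, b k * (J k).card ≤
        𝔼 ε, setMean μ (D ε) (blockSum f b J L ε) := by
  set p := 1 / (8 * M ^ 2) with hp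
  have hp0 : 0 < p := by have := hc.M_pos; positivity
  have hp1 : p ≤ 1 := by rw [hp, div_le_one (by positivity)]; nlinarith
  set S := ∑ k ∈ Finset.range L, b k * (J k).card with hS
  have hS0 : 0 ≤ S := Finset.sum_nonneg fun k _ => mul_nonneg (hb k) (Nat.cast_nonneg _)
  set E : ℕ → Set Ω := fun k => {x | ((J k).card : ℝ) / 8 ≤ ∑ j ∈ J k, truncAt M (f j x) ^ 2}
    with hE
  have hEm : ∀ k, MeasurableSet (E k) := fun k => measurableSet_le measurable_const
    (Finset.measurable_sum _ fun j _ => ((measurable_truncAt M).comp (hf j)).pow_const 2)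
  set G : Ω → ℝ := fun x => ∑ k ∈ Finset.range L, b k * (J k).card * if x ∈ E k then 1 else 0
    with hG
  have hite : ∀ k, Measurable fun x => if x ∈ E k then (1 : ℝ) else 0 := fun k =>
    Measurable.ite (hEm k) measurable_const measurable_const
  have hGm : Measurable G := Finset.measurable_sum _ fun k _ => (hite k).const_mul _
  have hbN : ∀ k, 0 ≤ b k * (J k).card := fun k => mul_nonneg (hb k) (Nat.cast_nonneg _)
  have hG0 : ∀ x, 0 ≤ G x := fun x => Finset.sum_nonneg fun k _ => by
    have := hbN k
    split_ifs <;> simp [this]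
  have hGS : ∀ x, G x ≤ S := fun x => Finset.sum_le_sum fun k _ => by
    have := hbN k
    split_ifs <;> simp [this]
  -- Every nonempty block is good on a set of measure at least `p`, so the good weight has mean at
  -- least `p S`; it therefore reaches `p S / 2` on a set of measure `p / 2`, the initial `B`.
  have hGint : p * S ≤ ∫ x, G x ∂μ := by
    have hii : ∀ k, Integrable (fun x => if x ∈ E k then (1 : ℝ) else 0) μ := fun k =>
      Integrable.of_bound (hite k).aestronglyMeasurable 1
        (ae_of_all _ fun x => by split_ifs <;> simp)
    have he : ∀ k, ∫ x, (if x ∈ E k then (1 : ℝ) else 0) ∂μ = μ.real (E k) := fun k => by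
      have := integral_indicator_one (μ := μ) (hEm k)
      rw [← this]; rfl
    simp only [hG]
    rw [integral_finsetSum _ fun k _ => (hii k).const_mul _, hS, Finset.mul_sum]
    refine Finset.sum_le_sum fun k hk => ?_
    rw [integral_const_mul, he, mul_comm]
    rcases (J k).eq_empty_or_nonempty with h | h
    · simp [h]
    · exact mul_le_mul_of_nonneg_left
        (le_measureReal_sum_truncAt_sq hc.M_pos hf (J k) (h4 k (Finset.mem_range.1 hk)) h) (hbN k)
  have hB := half_le_measureReal_of_le_integral hGm hp1 hS0 hG0 hGS hGint
  obtain ⟨D, -, hD, hDE⟩ := exists_sets_le_expect_setMean_blockSum hc hf hfi hsub L J b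
    {x | p * S / 2 ≤ G x} (p * S / 2) hb hdisj hgrow (measurableSet_le measurable_const hGm)
    (lt_of_lt_of_le (by positivity) hB) (fun hL => ⟨hfirst hL, (hN₀ _ (hfirst hL)).trans hB⟩)
    (fun x hx => by
      refine (show p * S / 2 ≤ G x from hx).trans (le_of_eq ?_)
      simp only [hG]
      rfl)
  refine ⟨D, fun ε => ⟨(hD ε).1, (hD ε).2.2⟩, le_trans (le_of_eq ?_) hDE⟩
  ring

end

/-- `β` is fixed first, making the smallness condition an equality; the remaining size conditions
then hold for all large `N`, which determines `N₀`. -/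
lemma exists_blockConstants {C : ℝ} (hC : 1 ≤ C) :
    ∃ β N₀ : ℝ, BlockConstants C (4 * C ^ 2) β N₀ ∧
      ∀ N : ℝ, N₀ ≤ N →
        2 * Real.exp (-(4 * (β * (4 * C ^ 2)) * N)) ≤ 1 / (8 * (4 * C ^ 2) ^ 2) / 2 := by
  set M := 4 * C ^ 2 with hM
  have hC0 : 0 < C := by linarith
  have hM0 : 0 < M := by positivity
  have hM1 : 1 ≤ M := by nlinarith
  set β := (1 / 48) ^ 2 / (16 * M * C ^ 2 * M ^ 2) with hβ
  have hβ0 : 0 < β := by positivity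
  have hsm : 16 * (β * M) * C ^ 2 * M ^ 2 = (1 / 48) ^ 2 := by
    rw [hβ]; field_simp
  have hβM : 0 < β * M := by positivity
  have h1 : ∀ᶠ N : ℝ in atTop, 1 ≤ 8 * (β * M) * N :=
    (tendsto_id.const_mul_atTop (by positivity : 0 < 8 * (β * M))).eventually_ge_atTop 1
  have h2 : ∀ᶠ N : ℝ in atTop, 16 * (β * M) * C ^ 2 + (β / 96) ^ 2 ≤
      (β / 96) ^ 2 * Real.exp (8 * (β * M) * N) :=
    ((Real.tendsto_exp_atTop.comp
      (tendsto_id.const_mul_atTop (by positivity : 0 < 8 * (β * M)))).const_mul_atTop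
      (by positivity : 0 < (β / 96) ^ 2)).eventually_ge_atTop _
  have h3 : ∀ᶠ N : ℝ in atTop,
      2 * Real.exp (-(4 * (β * M) * N)) ≤ 1 / (8 * M ^ 2) / 2 := by
    have := ((Real.tendsto_exp_neg_atTop_nhds_zero.comp
      (tendsto_id.const_mul_atTop (by positivity : 0 < 4 * (β * M)))).const_mul 2)
    rw [mul_zero] at this
    exact this.eventually_le_const (by positivity)
  obtain ⟨N₀, hN₀⟩ := eventually_atTop.1 (h1.and (h2.and h3))
  refine ⟨β, N₀, ⟨hC0, hβ0, hM0, ?_, hsm.le, fun N hN => (hN₀ N hN).1,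
    fun N hN => (hN₀ N hN).2.1⟩, fun N hN => (hN₀ N hN).2.2⟩
  have h5 : 1 ≤ C ^ 2 * M ^ 2 := one_le_mul_of_one_le_of_one_le (one_le_pow₀ hC) (one_le_pow₀ hM1)
  nlinarith

/-! ### Condensation of a decreasing sequence into geometric blocks -/

lemma sum_range_pow_le {α : ℕ → ℝ} (hα : Antitone α) {A : ℝ} (hA : α 0 ≤ A) (q L : ℕ) :
    ∑ i ∈ Finset.range (6 ^ (q + L)), α i ≤
      6 ^ q * A + ∑ k ∈ Finset.range L, α (6 ^ (q + k)) * (5 * 6 ^ (q + k)) := by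
  induction L with
  | zero =>
    simp only [add_zero, Finset.range_zero, Finset.sum_empty]
    calc _ ≤ ∑ i ∈ Finset.range (6 ^ q), A :=
          Finset.sum_le_sum fun i _ => (hα (Nat.zero_le i)).trans hA
      _ = _ := by simp
  | succ L ih =>
    have hle : 6 ^ (q + L) ≤ 6 ^ (q + (L + 1)) := Nat.pow_le_pow_right (by norm_num) (by omega)
    rw [← Finset.sum_range_add_sum_Ico _ hle, Finset.sum_range_succ, ← add_assoc (6 ^ q * A)]
    refine add_le_add ih ?_
    calc _ ≤ ∑ i ∈ Finset.Ico (6 ^ (q + L)) (6 ^ (q + (L + 1))), α (6 ^ (q + L)) :=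
          Finset.sum_le_sum fun i hi => hα (Finset.mem_Ico.1 hi).1
      _ = _ := by
          rw [Finset.sum_const, Nat.card_Ico, nsmul_eq_mul, Nat.cast_sub hle]
          push_cast; ring

/-- Decomposition of a finite family of nonnegative numbers into blocks of geometrically growing
size on which the family is bounded below. -/
lemma exists_blocks {ι : Type*} [DecidableEq ι] (s : Finset ι) (a : ι → ℝ) (ha : ∀ j, 0 ≤ a j)
    (A : ℝ) (hA0 : 0 ≤ A) (hA : ∀ j ∈ s, a j ≤ A) (q : ℕ) :
    ∃ (L : ℕ) (J : ℕ → Finset ι) (b : ℕ → ℝ), (∀ k, 0 ≤ b k) ∧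
      (∀ k l, k < l → l < L → Disjoint (J k) (J l)) ∧
      (∀ k, k + 1 < L → 6 * (J k).card ≤ (J (k + 1)).card) ∧
      (0 < L → 6 ^ q ≤ (J 0).card) ∧
      (∀ k < L, J k ⊆ s ∧ ∀ j ∈ J k, b k ≤ a j) ∧
      ∑ j ∈ s, a j ≤ 6 ^ (q + 1) * A + 6 * ∑ k ∈ Finset.range L, b k * (J k).card := by
  set n := s.card with hn
  let e : Fin n ≃ s := s.equivFin.symm
  let τ : Equiv.Perm (Fin n) := Tuple.sort fun i => -a (e i)
  have hmono : Monotone fun i => -a (e (τ i)) := Tuple.monotone_sort fun i => -a (e i)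
  let σ : Fin n → ι := fun i => e (τ i)
  have hσ : Function.Injective σ := fun i j h => τ.injective (e.injective (Subtype.ext h))
  have hσs : ∀ i, σ i ∈ s := fun i => (e (τ i)).2
  let α : ℕ → ℝ := fun i => if h : i < n then a (σ ⟨i, h⟩) else 0
  have hα0 : ∀ i, 0 ≤ α i := fun i => by
    simp only [α]; split_ifs with h
    · exact ha _
    · exact le_rfl
  have hα : Antitone α := by
    intro i j hij
    by_cases hj : j < n
    · have hi : i < n := by omega
      simp only [α, hi, hj, dif_pos]
      exact neg_le_neg_iff.1 (hmono (show (⟨i, hi⟩ : Fin n) ≤ ⟨j, hj⟩ from hij))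
    · have : α j = 0 := by simp [α, hj]
      rw [this]; exact hα0 i
  have hαA : α 0 ≤ A := by
    simp only [α]; split_ifs with h
    · exact hA _ (hσs _)
    · exact hA0
  have hsum : ∑ j ∈ s, a j = ∑ i ∈ Finset.range n, α i := by
    rw [Finset.sum_range, ← Finset.sum_coe_sort, ← Equiv.sum_comp (τ.trans e)]
    refine Finset.sum_congr rfl fun i _ => ?_
    simp [α, σ]
  have hex : ∃ L, n < 6 ^ (q + 1 + L) := ⟨n, by
    calc n < 6 ^ n := Nat.lt_pow_self (by norm_num)
      _ ≤ _ := Nat.pow_le_pow_right (by norm_num) (by omega)⟩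
  classical
  set L := Nat.find hex with hL
  have hLn : n < 6 ^ (q + 1 + L) := Nat.find_spec hex
  have hLk : ∀ k < L, 6 ^ (q + 1 + k) ≤ n := fun k hk => not_lt.1 (Nat.find_min hex hk)
  let I : ℕ → Finset (Fin n) := fun k =>
    Finset.univ.filter fun i => 6 ^ (q + k) ≤ i.1 ∧ i.1 < 6 ^ (q + 1 + k)
  have hcard : ∀ k < L, ((I k).image σ).card = 5 * 6 ^ (q + k) := by
    intro k hk
    rw [Finset.card_image_of_injective _ hσ]
    have : (I k).map Fin.valEmbedding = Finset.Ico (6 ^ (q + k)) (6 ^ (q + 1 + k)) := by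
      ext i
      simp only [I, Finset.mem_map, Finset.mem_filter, Finset.mem_univ, true_and,
        Fin.valEmbedding_apply, Finset.mem_Ico]
      constructor
      · rintro ⟨i, h, rfl⟩; exact h
      · intro h; exact ⟨⟨i, h.2.trans_le (hLk k hk)⟩, h, rfl⟩
    rw [← Finset.card_map, this, Nat.card_Ico]
    have : 6 ^ (q + 1 + k) = 6 * 6 ^ (q + k) := by ring
    omega
  -- The block of ranks from `6 ^ (q + k)` up to `6 ^ (q + 1 + k)` gets the value at its right end,
  -- a lower bound on the block. That value bounds the following range, six times as long, from
  -- above: hence the factor `6` and the first `6 ^ (q + 1)` terms left to the bound `A`.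
  refine ⟨L, fun k => (I k).image σ, fun k => α (6 ^ (q + 1 + k)), fun k => hα0 _, ?_, ?_, ?_, ?_,
    ?_⟩
  · intro k l hkl hl
    rw [Finset.disjoint_image hσ, Finset.disjoint_left]
    intro i hi hi'
    simp only [I, Finset.mem_filter] at hi hi'
    have : 6 ^ (q + 1 + k) ≤ 6 ^ (q + l) := Nat.pow_le_pow_right (by norm_num) (by omega)
    omega
  · intro k hk
    rw [hcard k (by omega), hcard (k + 1) hk]
    exact le_of_eq (by ring)
  · intro h
    rw [hcard 0 h, add_zero]
    omega
  · intro k hk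
    refine ⟨Finset.image_subset_iff.2 fun i _ => hσs i, fun j hj => ?_⟩
    obtain ⟨i, hi, rfl⟩ := Finset.mem_image.1 hj
    simp only [I, Finset.mem_filter] at hi
    have h1 : α i = a (σ i) := by simp [α]
    rw [← h1]
    exact hα hi.2.2.le
  · rw [hsum]
    calc ∑ i ∈ Finset.range n, α i ≤ ∑ i ∈ Finset.range (6 ^ (q + 1 + L)), α i :=
          Finset.sum_le_sum_of_subset_of_nonneg (Finset.range_mono hLn.le) fun i _ _ => hα0 i
      _ ≤ _ := sum_range_pow_le hα hαA (q + 1) L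
      _ = _ := by
          rw [Finset.mul_sum]
          congr 1
          refine Finset.sum_congr rfl fun k hk => ?_
          rw [hcard k (Finset.mem_range.1 hk)]
          push_cast; ring

/-! ### Complex systems: contraction and reduction to real parts -/

section Complex

variable {Ω ι : Type*} [MeasurableSpace Ω] {μ : Measure Ω}

lemma eLpNorm_two_le_eLpNorm_top [IsProbabilityMeasure μ] {F : Ω → ℂ} (hF : AEStronglyMeasurable F μ) :
    eLpNorm F 2 μ ≤ eLpNorm F ∞ μ :=
  eLpNorm_le_eLpNorm_of_exponent_le le_top hF

lemma ofReal_setMean_le_eLpNorm_top [IsFiniteMeasure μ] {D : Set Ω} (hD0 : 0 < μ.real D)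
    {G : Ω → ℝ} (hG : Integrable G μ) {F : Ω → ℂ} (h : ∀ x, G x ≤ ‖F x‖) :
    ENNReal.ofReal (setMean μ D G) ≤ eLpNorm F ∞ μ := by
  by_cases htop : eLpNorm F ∞ μ = ⊤
  · simp [htop]
  rw [← ENNReal.ofReal_toReal htop]
  refine ENNReal.ofReal_le_ofReal ?_
  set N := (eLpNorm F ∞ μ).toReal
  have hae : ∀ᵐ x ∂μ, G x ≤ N := by
    have : ∀ᵐ x ∂μ, ‖F x‖ₑ ≤ eLpNorm F ∞ μ := by
      rw [eLpNorm_exponent_top]; exact ae_le_eLpNormEssSup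
    filter_upwards [this] with x hx
    refine (h x).trans ?_
    rw [← toReal_enorm]
    exact ENNReal.toReal_mono htop hx
  rw [setMean, div_le_iff₀ hD0]
  have := integral_mono_ae (μ := μ.restrict D) hG.integrableOn (integrable_const N)
    (ae_restrict_of_ae hae)
  simpa [mul_comm] using this

lemma exists_lt_of_orliczNorm_lt {Φ : ℝ → ℝ} {F : Ω → ℂ} {T : ℝ}
    (h : orliczNorm Φ F μ < ENNReal.ofReal T) :
    ∃ t : ℝ, 0 < t ∧ t < T ∧ ∫⁻ x, ENNReal.ofReal (Φ (‖F x‖ / t)) ∂μ ≤ 1 := by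
  simp only [orliczNorm, iInf_lt_iff] at h
  obtain ⟨t, ht, h1, h2⟩ := h
  refine ⟨t, ht, ?_, h1⟩
  by_contra hle
  exact absurd h2 (not_lt.2 (ENNReal.ofReal_le_ofReal (not_lt.1 hle)))

/-- Enlarging `C` to `|C| + 1` makes the norm bound strict, so the infimum in the Luxemburg norm
supplies an admissible `t` below `(|C| + 1) √V`. The constant `2` is the `1` of the norm plus the
`1` subtracted in `psiTwo`. -/
lemma PsiTwoCondition.subgaussianSystem_re [IsProbabilityMeasure μ] {C : ℝ} {φ : ι → Ω → ℂ}
    (hφ : PsiTwoCondition C φ μ) {θ : ι → ℂ} (hθ : ∀ j, ‖θ j‖ = 1) :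
    SubgaussianSystem (|C| + 1) (fun j x => (θ j * φ j x).re) μ := by
  intro K c V hV hcV
  have hK := hφ K fun j => c j * θ j
  have hnorm : ∀ j, ‖(c j : ℂ) * θ j‖ ^ 2 = c j ^ 2 := fun j => by
    rw [norm_mul, hθ, mul_one, Complex.norm_real, Real.norm_eq_abs, sq_abs]
  simp only [hnorm] at hK
  have hs : 0 < Real.sqrt V := Real.sqrt_pos.2 hV
  have hlt : C * Real.sqrt (∑ j ∈ K, c j ^ 2) < (|C| + 1) * Real.sqrt V := by
    calc C * Real.sqrt (∑ j ∈ K, c j ^ 2) ≤ |C| * Real.sqrt V :=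
          mul_le_mul (le_abs_self C) (Real.sqrt_le_sqrt hcV) (Real.sqrt_nonneg _) (abs_nonneg C)
      _ < _ := by linarith
  obtain ⟨t, ht0, htT, ht⟩ := exists_lt_of_orliczNorm_lt
    (hK.trans_lt ((ENNReal.ofReal_lt_ofReal_iff (by positivity)).2 hlt))
  have hV2 : (|C| + 1) ^ 2 * V = ((|C| + 1) * Real.sqrt V) ^ 2 := by
    rw [mul_pow, Real.sq_sqrt hV.le]
  have hpt : ∀ x, ENNReal.ofReal (Real.exp
      ((∑ j ∈ K, c j * (θ j * φ j x).re) ^ 2 / ((|C| + 1) ^ 2 * V))) ≤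
      ENNReal.ofReal (psiTwo (‖∑ j ∈ K, (c j : ℂ) * θ j * φ j x‖ / t)) + 1 := by
    intro x
    have hre : ∑ j ∈ K, c j * (θ j * φ j x).re = (∑ j ∈ K, (c j : ℂ) * θ j * φ j x).re := by
      rw [Complex.re_sum]
      refine Finset.sum_congr rfl fun j _ => ?_
      rw [mul_assoc, Complex.re_ofReal_mul]
    set z := ∑ j ∈ K, (c j : ℂ) * θ j * φ j x
    have h1 : (z.re) ^ 2 / ((|C| + 1) ^ 2 * V) ≤ |‖z‖ / t| ^ 2 := by
      rw [sq_abs, div_pow, hV2]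
      have : z.re ^ 2 ≤ ‖z‖ ^ 2 := by
        rw [← sq_abs]; exact pow_le_pow_left₀ (abs_nonneg _) (Complex.abs_re_le_norm z) 2
      gcongr
    rw [hre, ← ENNReal.ofReal_one, ← ENNReal.ofReal_add _ zero_le_one]
    · refine ENNReal.ofReal_le_ofReal ?_
      simp only [psiTwo, sub_add_cancel]
      exact Real.exp_le_exp.2 h1
    · simp only [psiTwo]
      linarith [Real.add_one_le_exp (|‖z‖ / t| ^ 2), sq_nonneg |‖z‖ / t|]
  calc _ ≤ ∫⁻ x, (ENNReal.ofReal (psiTwo (‖∑ j ∈ K, (c j : ℂ) * θ j * φ j x‖ / t)) + 1) ∂μ :=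
        lintegral_mono hpt
    _ = ∫⁻ x, ENNReal.ofReal (psiTwo (‖∑ j ∈ K, (c j : ℂ) * θ j * φ j x‖ / t)) ∂μ + 1 := by
        rw [lintegral_add_right _ measurable_const]; simp
    _ ≤ 1 + 1 := by gcongr
    _ = 2 := by norm_num

lemma SubgaussianSystem.lintegral_exp_sq_le {C : ℝ} {f : ι → Ω → ℝ} (h : SubgaussianSystem C f μ)
    (j : ι) : ∫⁻ x, ENNReal.ofReal (Real.exp (f j x ^ 2 / C ^ 2)) ∂μ ≤ 2 := by
  simpa using h {j} (fun _ => 1) 1 one_pos (by simp)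

lemma SubgaussianSystem.integrable_sq [IsProbabilityMeasure μ] {C : ℝ} (hC : 0 < C)
    {f : ι → Ω → ℝ} (h : SubgaussianSystem C f μ) (hf : ∀ j, Measurable (f j)) (j : ι) :
    Integrable (fun x => f j x ^ 2) μ :=
  (integral_sq_le_of_measure_le one_pos hC (by simp) (hf j) (h.lintegral_exp_sq_le j)).1

variable [Fintype ι] [DecidableEq ι] {φ : ι → Ω → ℂ}

/-- The sum of the essential suprema of `∑ ε_j a_j φ_j` over all choices of signs. -/
noncomputable def signNormSum (μ : Measure Ω) (φ : ι → Ω → ℂ) (a : ι → ℂ) : ℝ≥0∞ :=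
  ∑ ε : ι → ℤˣ, eLpNorm (fun x => ∑ j, ((ε j : ℤ) : ℂ) * a j * φ j x) ∞ μ

omit [DecidableEq ι] in
lemma measurable_signSum (hφ : ∀ j, Measurable (φ j)) (a : ι → ℂ) (ε : ι → ℤˣ) :
    Measurable fun x => ∑ j, ((ε j : ℤ) : ℂ) * a j * φ j x :=
  Finset.measurable_sum _ fun j _ => (hφ j).const_mul _

/-- Convexity: `t` is the average of `1` and `-1` with weights `(1 + t) / 2` and `(1 - t) / 2`, and
flipping the sign of index `i` permutes the sum over all signs. -/
lemma signNormSum_update_le (hφ : ∀ j, Measurable (φ j)) (a : ι → ℂ) (i : ι)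
    {t : ℝ} (h0 : 0 ≤ t) (h1 : t ≤ 1) :
    signNormSum μ φ (Function.update a i (t * a i)) ≤ signNormSum μ φ a := by
  let flip : Equiv.Perm (ι → ℤˣ) := Equiv.mulRight (Pi.mulSingle i (-1))
  have hstep : ∀ ε : ι → ℤˣ,
      eLpNorm (fun x => ∑ j, ((ε j : ℤ) : ℂ) * Function.update a i (t * a i) j * φ j x) ∞ μ ≤
      ENNReal.ofReal ((1 + t) / 2) *
        eLpNorm (fun x => ∑ j, ((ε j : ℤ) : ℂ) * a j * φ j x) ∞ μ +
      ENNReal.ofReal ((1 - t) / 2) *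
        eLpNorm (fun x => ∑ j, ((flip ε j : ℤ) : ℂ) * a j * φ j x) ∞ μ := by
    intro ε
    have hn : ∀ y : ℝ, 0 ≤ y → ‖y‖ₑ = ENNReal.ofReal y := fun y hy => by
      rw [Real.enorm_eq_ofReal hy]
    have hfun : (fun x => ∑ j, ((ε j : ℤ) : ℂ) * Function.update a i (t * a i) j * φ j x) =
        ((1 + t) / 2 : ℝ) • (fun x => ∑ j, ((ε j : ℤ) : ℂ) * a j * φ j x) +
        ((1 - t) / 2 : ℝ) • (fun x => ∑ j, ((flip ε j : ℤ) : ℂ) * a j * φ j x) := by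
      ext x
      simp only [Pi.add_apply, Pi.smul_apply, Finset.smul_sum, ← Finset.sum_add_distrib]
      refine Finset.sum_congr rfl fun j _ => ?_
      by_cases hj : j = i
      · subst hj
        simp only [flip, Equiv.coe_mulRight, Pi.mul_apply, Pi.mulSingle_eq_same,
          Function.update_self, Complex.real_smul]
        push_cast; ring
      · simp only [flip, Equiv.coe_mulRight, Pi.mul_apply, Pi.mulSingle_eq_of_ne hj,
          Function.update_of_ne hj, Complex.real_smul]
        push_cast; ring
    rw [hfun]
    refine (eLpNorm_add_le ((measurable_signSum hφ a ε).const_smul _).aestronglyMeasurable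
      ((measurable_signSum hφ a _).const_smul _).aestronglyMeasurable le_top).trans ?_
    rw [eLpNorm_const_smul, eLpNorm_const_smul, hn _ (by linarith), hn _ (by linarith)]
  have hflip : ∑ ε, eLpNorm (fun x => ∑ j, ((flip ε j : ℤ) : ℂ) * a j * φ j x) ∞ μ =
      signNormSum μ φ a :=
    Equiv.sum_comp flip fun ε => eLpNorm (fun x => ∑ j, ((ε j : ℤ) : ℂ) * a j * φ j x) ∞ μ
  refine (Finset.sum_le_sum fun ε _ => hstep ε).trans (le_of_eq ?_)
  rw [Finset.sum_add_distrib, ← Finset.mul_sum, ← Finset.mul_sum, hflip, ← signNormSum, ← add_mul,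
    ← ENNReal.ofReal_add (by linarith) (by linarith)]
  have : (1 + t) / 2 + (1 - t) / 2 = 1 := by ring
  rw [this, ENNReal.ofReal_one, one_mul]

/-- The contraction principle. -/
lemma signNormSum_mul_le (hφ : ∀ j, Measurable (φ j)) (a : ι → ℂ) {t : ι → ℝ}
    (h0 : ∀ j, 0 ≤ t j) (h1 : ∀ j, t j ≤ 1) :
    signNormSum μ φ (fun j => t j * a j) ≤ signNormSum μ φ a := by
  have h : ∀ s : Finset ι,
      signNormSum μ φ (fun j => if j ∈ s then t j * a j else a j) ≤ signNormSum μ φ a := by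
    intro s
    induction s using Finset.induction_on with
    | empty => simp
    | insert i s hi ih =>
      refine le_trans (le_of_eq ?_) ((signNormSum_update_le hφ
        (fun j => if j ∈ s then t j * a j else a j) i (h0 i) (h1 i)).trans ih)
      congr 1
      ext j
      by_cases hj : j = i
      · subst hj; simp [hi]
      · simp [hj]
  simpa using h Finset.univ

/-- Contraction to the single index `j`, followed by `1 = ‖φ_j‖₂ ≤ ‖φ_j‖_∞`. It controls the few
largest coefficients, which lie in no block. -/
lemma card_mul_enorm_le_signNormSum [IsProbabilityMeasure μ] (hφ : ∀ j, Measurable (φ j))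
    (h2 : ∀ j, eLpNorm (φ j) 2 μ = 1) (a : ι → ℂ) (j : ι) :
    (Fintype.card (ι → ℤˣ) : ℝ≥0∞) * ‖a j‖ₑ ≤ signNormSum μ φ a := by
  refine le_trans ?_ (signNormSum_mul_le hφ a (t := Pi.single j 1)
    (fun i => by by_cases h : i = j <;> simp [h])
    (fun i => by by_cases h : i = j <;> simp [h]))
  have hle : ∀ ε : ι → ℤˣ, ‖a j‖ₑ ≤
      eLpNorm (fun x => ∑ i, ((ε i : ℤ) : ℂ) * ((Pi.single j 1 : ι → ℝ) i * a i) * φ i x) ∞ μ := by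
    intro ε
    have hfun : (fun x => ∑ i, ((ε i : ℤ) : ℂ) * ((Pi.single j 1 : ι → ℝ) i * a i) * φ i x) =
        (((ε j : ℤ) : ℂ) * a j) • φ j := by
      ext x
      rw [Finset.sum_eq_single j]
      · simp
      · intro i _ hi; simp [hi]
      · simp
    have hsign : ‖((ε j : ℤ) : ℂ)‖ₑ = 1 := by
      rcases Int.units_eq_one_or (ε j) with h | h <;> simp [h]
    rw [hfun, eLpNorm_const_smul, enorm_mul, hsign, one_mul]
    have := eLpNorm_two_le_eLpNorm_top (μ := μ) (hφ j).aestronglyMeasurable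
    rw [h2 j] at this
    exact le_mul_of_one_le_right' this
  calc _ = ∑ _ε : ι → ℤˣ, ‖a j‖ₑ := by simp [Finset.sum_const, Finset.card_univ]
    _ ≤ _ := Finset.sum_le_sum fun ε _ => hle ε

/-- The Sidon inequality for the coefficients whose functions have a large real part. -/
lemma sum_norm_le_of_half_le_integral_re [IsProbabilityMeasure μ] {C β N₀ : ℝ}
    (hc : BlockConstants (|C| + 1) (4 * (|C| + 1) ^ 2) β N₀)
    (hN₀ : ∀ N : ℝ, N₀ ≤ N → 2 * Real.exp (-(4 * (β * (4 * (|C| + 1) ^ 2)) * N)) ≤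
      1 / (8 * (4 * (|C| + 1) ^ 2) ^ 2) / 2)
    {q : ℕ} (hq : N₀ ≤ 6 ^ q)
    (hφ : ∀ j, Measurable (φ j)) (h2 : ∀ j, eLpNorm (φ j) 2 μ = 1) (hψ : PsiTwoCondition C φ μ)
    (a θ : ι → ℂ) (hθ : ∀ j, ‖θ j‖ = 1) {τ : ℂ} (hτ : ‖τ‖ = 1) (ha : ∀ j, a j = ‖a j‖ * (τ⁻¹ * θ j))
    {P : ℝ} (hP0 : 0 ≤ P)
    (hP : signNormSum μ φ a ≤ Fintype.card (ι → ℤˣ) * ENNReal.ofReal P) (s : Finset ι)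
    (hs : ∀ j ∈ s, 1 / 2 ≤ ∫ x, (θ j * φ j x).re ^ 2 ∂μ) :
    ∑ j ∈ s, ‖a j‖ ≤
      (6 ^ (q + 1) + 6 / (β / 96 * (1 / (8 * (4 * (|C| + 1) ^ 2) ^ 2) / 2))) * P := by
  set M := 4 * (|C| + 1) ^ 2 with hM
  set δ := β / 96 * (1 / (8 * M ^ 2) / 2) with hδ
  have hβ := hc.beta_pos
  have hM0 := hc.M_pos
  have hδ0 : 0 < δ := by positivity
  have hC0 : 0 < |C| + 1 := by positivity
  have hM1 : 1 ≤ M := by nlinarith [abs_nonneg C]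
  set n := Fintype.card (ι → ℤˣ) with hn
  have hn0 : (0 : ℝ) < n := by exact_mod_cast Fintype.card_pos
  have hnE0 : (n : ℝ≥0∞) ≠ 0 := by exact_mod_cast Fintype.card_ne_zero
  have hA : ∀ j ∈ s, ‖a j‖ ≤ P := by
    intro j _
    have h := (card_mul_enorm_le_signNormSum hφ h2 a j).trans hP
    rw [ENNReal.mul_le_mul_iff_right hnE0 (by simp), ← ofReal_norm] at h
    exact (ENNReal.ofReal_le_ofReal_iff hP0).1 h
  obtain ⟨L, J, b, hb, hdisj, hgrow, hfirst, hJ, hsum⟩ :=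
    exists_blocks s (fun j => ‖a j‖) (fun j => norm_nonneg _) P hP0 hA q
  set f : ι → Ω → ℝ := fun j x => (θ j * φ j x).re with hf
  have hfm : ∀ j, Measurable (f j) := fun j => Complex.measurable_re.comp ((hφ j).const_mul _)
  have hsub : SubgaussianSystem (|C| + 1) f μ := hψ.subgaussianSystem_re hθ
  have hfi : ∀ j, Integrable (f j) μ := fun j =>
    (sq_integral_le (hfm j) (hsub.integrable_sq hC0 hfm j)).1
  obtain ⟨D, hD, hDE⟩ := exists_sets_mul_sum_le_expect_setMean hc hM1 hN₀ hfm hfi hsub L J b hb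
    hdisj hgrow (fun hL => hq.trans (by exact_mod_cast hfirst hL))
    (fun k hk j hj => quarter_le_integral_truncAt_sq hC0 (hfm j) (hsub.lintegral_exp_sq_le j)
      (hs j ((hJ k hk).1 hj)))
  rw [← hδ] at hDE
  set b' : ι → ℝ := fun j => ∑ k ∈ Finset.range L, if j ∈ J k then b k else 0 with hb'
  have hb'0 : ∀ j, 0 ≤ b' j := fun j => Finset.sum_nonneg fun k _ => by
    have := hb k
    split_ifs <;> simp [this]
  have hb'a : ∀ j, b' j ≤ ‖a j‖ := by
    intro j
    by_cases h : ∃ k < L, j ∈ J k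
    · obtain ⟨k, hk, hj⟩ := h
      simp only [hb']
      rw [Finset.sum_eq_single k]
      · rw [if_pos hj]; exact (hJ k hk).2 j hj
      · intro l hl hlk
        rw [Finset.mem_range] at hl
        refine if_neg fun hjl => ?_
        rcases lt_or_gt_of_ne hlk with h | h
        · exact Finset.disjoint_left.1 (hdisj l k h hk) hjl hj
        · exact Finset.disjoint_left.1 (hdisj k l h hl) hj hjl
      · intro h; exact absurd (Finset.mem_range.2 hk) h
    · have : b' j = 0 := Finset.sum_eq_zero fun k hk => if_neg fun hj =>
        h ⟨k, Finset.mem_range.1 hk, hj⟩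
      rw [this]; exact norm_nonneg _
  -- Multipliers in `[0, 1]` that lower each modulus to its block value and kill the indices outside
  -- the blocks; where `a j = 0`, also `b' j = 0`, so division by zero is harmless.
  set t : ι → ℝ := fun j => b' j / ‖a j‖ with ht
  have hta : ∀ j, (t j : ℂ) * a j = b' j * (τ⁻¹ * θ j) := by
    intro j
    by_cases h : ‖a j‖ = 0
    · have h3 : b' j = 0 := le_antisymm (h ▸ hb'a j) (hb'0 j)
      simp [ht, h, h3]
    · conv_lhs => rw [ha j]
      rw [← mul_assoc, ← Complex.ofReal_mul]
      simp only [ht]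
      rw [div_mul_cancel₀ _ h]
  -- The common phase `τ` does not change the modulus of the sum; it allows the same argument to
  -- serve real parts (`τ = 1`) and imaginary parts (`τ = -i`).
  have hblock : ∀ (ε : ι → ℤˣ) x, blockSum f b J L ε x =
      (τ * ∑ j, ((ε j : ℤ) : ℂ) * ((t j : ℂ) * a j) * φ j x).re := by
    intro ε x
    have hτ0 : τ ≠ 0 := by rintro rfl; simp at hτ
    have e1 : τ * ∑ j, ((ε j : ℤ) : ℂ) * ((t j : ℂ) * a j) * φ j x =
        ∑ j, ((b' j * ((ε j : ℤ) : ℝ) : ℝ) : ℂ) * (θ j * φ j x) := by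
      rw [Finset.mul_sum]
      refine Finset.sum_congr rfl fun j _ => ?_
      rw [hta]; push_cast; field_simp
    rw [e1, Complex.re_sum]
    simp only [Complex.re_ofReal_mul, hb', Finset.sum_mul]
    rw [Finset.sum_comm, blockSum]
    refine Finset.sum_congr rfl fun k _ => ?_
    simp only [ite_mul, zero_mul]
    rw [← Finset.sum_filter, Finset.filter_mem_eq_inter, Finset.univ_inter, Finset.mul_sum]
    exact Finset.sum_congr rfl fun j _ => by ring
  have hmean : ∀ ε, ENNReal.ofReal (setMean μ (D ε) (blockSum f b J L ε)) ≤
      eLpNorm (fun x => ∑ j, ((ε j : ℤ) : ℂ) * ((t j : ℂ) * a j) * φ j x) ∞ μ := fun ε =>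
    ofReal_setMean_le_eLpNorm_top (hD ε).2 (integrable_blockSum hfi b J L ε) fun x => by
      rw [hblock]
      refine (Complex.re_le_norm _).trans ?_
      rw [norm_mul, hτ, one_mul]
  have hδP : δ * ∑ k ∈ Finset.range L, b k * (J k).card ≤ P := by
    refine hDE.trans ?_
    have h3 : ENNReal.ofReal (∑ ε, setMean μ (D ε) (blockSum f b J L ε)) ≤
        ENNReal.ofReal (n * P) := by
      calc _ ≤ ∑ ε, ENNReal.ofReal (setMean μ (D ε) (blockSum f b J L ε)) :=
            Finset.le_sum_of_subadditive _ ENNReal.ofReal_zero.le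
              (fun _ _ => ENNReal.ofReal_add_le) _ _
        _ ≤ signNormSum μ φ (fun j => t j * a j) := Finset.sum_le_sum fun ε _ => hmean ε
        _ ≤ signNormSum μ φ a := signNormSum_mul_le hφ a
            (fun j => div_nonneg (hb'0 j) (norm_nonneg _))
            (fun j => div_le_one_of_le₀ (hb'a j) (norm_nonneg _))
        _ ≤ _ := hP
        _ = _ := by rw [ENNReal.ofReal_mul hn0.le, ENNReal.ofReal_natCast]
    have h4 := (ENNReal.ofReal_le_ofReal_iff (by positivity)).1 h3
    rw [Fintype.expect_eq_sum_div_card, div_le_iff₀ hn0]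
    linarith
  calc _ ≤ 6 ^ (q + 1) * P + 6 * ∑ k ∈ Finset.range L, b k * (J k).card := hsum
    _ ≤ 6 ^ (q + 1) * P + 6 * (P / δ) := by
        gcongr
        rw [le_div_iff₀ hδ0]; linarith
    _ = _ := by ring

end Complex

/-- The Sidon inequality for averages over signs of finite systems. -/
theorem exists_mul_sum_enorm_le_signNormSum (C : ℝ) :
    ∃ γ : ℝ, 0 < γ ∧ ∀ (ι : Type*) [Fintype ι] [DecidableEq ι] (Ω : Type*) [MeasurableSpace Ω] (μ : Measure Ω)
      [IsProbabilityMeasure μ] (φ : ι → Ω → ℂ), (∀ j, Measurable (φ j)) →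
      (∀ j, eLpNorm (φ j) 2 μ = 1) → PsiTwoCondition C φ μ → ∀ a : ι → ℂ,
      Fintype.card (ι → ℤˣ) * (ENNReal.ofReal γ * ∑ j, ‖a j‖ₑ) ≤ signNormSum μ φ a := by
  have hC1 : 1 ≤ |C| + 1 := by linarith [abs_nonneg C]
  obtain ⟨β, N₀, hc, hN₀⟩ := exists_blockConstants hC1
  obtain ⟨q, hq⟩ : ∃ q : ℕ, N₀ ≤ 6 ^ q := pow_unbounded_of_one_lt N₀ (by norm_num) |>.imp
    fun q h => h.le
  set Γ := 6 ^ (q + 1) + 6 / (β / 96 * (1 / (8 * (4 * (|C| + 1) ^ 2) ^ 2) / 2)) with hΓ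
  have hβ := hc.beta_pos
  have hΓ0 : 0 < Γ := by positivity
  refine ⟨1 / (2 * Γ), by positivity, ?_⟩
  intro ι _ _ Ω _ μ _ φ hφ h2 hψ a
  set n := Fintype.card (ι → ℤˣ) with hn
  have hn0 : (0 : ℝ) < n := by exact_mod_cast Fintype.card_pos
  by_cases htop : signNormSum μ φ a = ⊤
  · rw [htop]; exact le_top
  set P := (signNormSum μ φ a).toReal / n with hPdef
  have hP0 : 0 ≤ P := by positivity
  have hP : signNormSum μ φ a = n * ENNReal.ofReal P := by
    rw [← ENNReal.ofReal_natCast, ← ENNReal.ofReal_mul hn0.le, hPdef, mul_div_cancel₀ _ hn0.ne',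
      ENNReal.ofReal_toReal htop]
  let θ : ι → ℂ := fun j => if a j = 0 then 1 else a j / ‖a j‖
  have hθ : ∀ j, ‖θ j‖ = 1 := by
    intro j
    simp only [θ]
    split_ifs with h
    · simp
    · rw [norm_div, Complex.norm_real, norm_norm, div_self (norm_ne_zero_iff.2 h)]
  have ha : ∀ j, a j = ‖a j‖ * θ j := by
    intro j
    simp only [θ]
    split_ifs with h
    · simp [h]
    · rw [mul_div_cancel₀]
      exact_mod_cast norm_ne_zero_iff.2 h
  have hIθ : ∀ j, ‖-Complex.I * θ j‖ = 1 := fun j => by simp [hθ]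
  let s : Finset ι := Finset.univ.filter fun j => 1 / 2 ≤ ∫ x, (θ j * φ j x).re ^ 2 ∂μ
  have hC0 : 0 < |C| + 1 := by linarith
  have hre : ∀ j, Integrable (fun x => (θ j * φ j x).re ^ 2) μ :=
    (hψ.subgaussianSystem_re hθ).integrable_sq hC0
      fun j => Complex.measurable_re.comp ((hφ j).const_mul _)
  have him : ∀ j, Integrable (fun x => (-Complex.I * θ j * φ j x).re ^ 2) μ :=
    (hψ.subgaussianSystem_re hIθ).integrable_sq hC0
      fun j => Complex.measurable_re.comp ((hφ j).const_mul _)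
  have hone : ∀ j, ∫ x, ‖φ j x‖ ^ 2 ∂μ = 1 := by
    intro j
    have hm : MemLp (φ j) 2 μ := ⟨(hφ j).aestronglyMeasurable, by rw [h2 j]; simp⟩
    have h3 := hm.eLpNorm_eq_integral_rpow_norm (by simp) (by simp)
    rw [h2 j] at h3
    have h4 : (∫ x, ‖φ j x‖ ^ (2 : ℝ≥0∞).toReal ∂μ) ^ (2 : ℝ≥0∞).toReal⁻¹ = 1 := by
      rw [eq_comm, ENNReal.ofReal_eq_one] at h3; exact h3
    simp only [ENNReal.toReal_ofNat, Real.rpow_ofNat] at h4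
    have h5 : 0 ≤ ∫ x, ‖φ j x‖ ^ 2 ∂μ := integral_nonneg fun x => by positivity
    calc _ = ((∫ x, ‖φ j x‖ ^ 2 ∂μ) ^ (2 : ℝ)⁻¹) ^ (2 : ℝ) := by
          rw [← Real.rpow_mul h5]; norm_num
      _ = 1 := by rw [h4]; norm_num
  have hsum1 : ∑ j ∈ s, ‖a j‖ ≤ Γ * P :=
    sum_norm_le_of_half_le_integral_re hc hN₀ hq hφ h2 hψ a θ hθ (τ := 1) (by simp)
      (by simpa using ha) hP0 hP.le s fun j hj => (Finset.mem_filter.1 hj).2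
  -- The squares of the real and imaginary parts of `θ_j φ_j` have integrals adding up to `1`, so
  -- off `s` the imaginary part, which is the real part after rotation by `-i`, carries at least
  -- half.
  have hsum2 : ∑ j ∈ sᶜ, ‖a j‖ ≤ Γ * P := by
    refine sum_norm_le_of_half_le_integral_re hc hN₀ hq hφ h2 hψ a (fun j => -Complex.I * θ j) hIθ
      (τ := -Complex.I) (by simp) (fun j => ?_) hP0 hP.le sᶜ fun j hj => ?_
    · rw [inv_mul_cancel_left₀ (by simp)]; exact ha j
    · have h3 : ∫ x, (θ j * φ j x).re ^ 2 ∂μ < 1 / 2 := by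
        rw [Finset.mem_compl, Finset.mem_filter] at hj
        simpa using hj
      have h4 : ∀ x, ‖φ j x‖ ^ 2 = (θ j * φ j x).re ^ 2 + (-Complex.I * θ j * φ j x).re ^ 2 := by
        intro x
        have h5 : ‖φ j x‖ = ‖θ j * φ j x‖ := by rw [norm_mul, hθ, one_mul]
        rw [h5, Complex.sq_norm, Complex.normSq_apply, mul_assoc]
        simp
        ring
      have h6 := hone j
      simp only [h4] at h6
      rw [integral_add (hre j) (him j)] at h6
      linarith
  have htotal : ∑ j, ‖a j‖ ≤ 2 * Γ * P := by
    rw [← Finset.sum_add_sum_compl s]; linarith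
  rw [hP]
  gcongr
  have : ∑ j, ‖a j‖ₑ = ENNReal.ofReal (∑ j, ‖a j‖) := by
    rw [ENNReal.ofReal_sum_of_nonneg fun j _ => norm_nonneg _]
    simp
  rw [this, ← ENNReal.ofReal_mul (by positivity)]
  refine ENNReal.ofReal_le_ofReal ?_
  rw [one_div, inv_mul_le_iff₀ (by positivity)]
  exact htotal

/-! ### From sign averages to Rademacher functions -/

section Rademacher

variable {Ω' : Type*} [MeasurableSpace Ω'] {P : Measure Ω'}

lemma IsRademacherFamily.precomp {ι κ : Type*} {r : ι → Ω' → ℝ} (h : IsRademacherFamily r P)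
    {g : κ → ι} (hg : Function.Injective g) : IsRademacherFamily (fun k => r (g k)) P :=
  ⟨fun _ => h.1 _, fun _ => h.2.1 _, h.2.2.precomp hg⟩

lemma IsRademacherFamily.measure_eq_sign {ι : Type*} {r : ι → Ω' → ℝ} (h : IsRademacherFamily r P)
    (j : ι) (u : ℤˣ) : P (r j ⁻¹' {((u : ℤ) : ℝ)}) = 1 / 2 := by
  rcases Int.units_eq_one_or u with rfl | rfl
  · rw [← (h.2.1 j).1]
    congr 1; ext ω; simp
  · rw [← (h.2.1 j).2]
    congr 1; ext ω; simp

/-- The sign patterns are disjoint events of equal probability `2 ^ (-card ι)`. Bounding a simple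
function by `F` from below avoids any measurability of `F`. -/
lemma IsRademacherFamily.sum_le_card_mul_lintegral {ι : Type*} [Fintype ι] [DecidableEq ι]
    {r : ι → Ω' → ℝ} (h : IsRademacherFamily r P) (H : (ι → ℤˣ) → ℝ≥0∞) (F : Ω' → ℝ≥0∞)
    (hHF : ∀ ε ω, (∀ j, r j ω = ((ε j : ℤ) : ℝ)) → H ε ≤ F ω) :
    ∑ ε, H ε ≤ Fintype.card (ι → ℤˣ) * ∫⁻ ω, F ω ∂P := by
  let A : (ι → ℤˣ) → Set Ω' := fun ε => ⋂ j, r j ⁻¹' {((ε j : ℤ) : ℝ)}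
  have hAm : ∀ ε, MeasurableSet (A ε) := fun ε =>
    MeasurableSet.iInter fun j => h.1 j (measurableSet_singleton _)
  have hcard : (Fintype.card (ι → ℤˣ) : ℝ≥0∞) = 2 ^ Fintype.card ι := by
    simp
  have hPA : ∀ ε, Fintype.card (ι → ℤˣ) * P (A ε) = 1 := by
    intro ε
    have h1 : P (A ε) = ∏ j, P (r j ⁻¹' {((ε j : ℤ) : ℝ)}) :=
      h.2.2.meas_iInter fun j => ⟨_, measurableSet_singleton _, rfl⟩
    simp only [h.measure_eq_sign] at h1
    rw [h1, hcard, Finset.prod_const, Finset.card_univ, ← mul_pow, one_div,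
      ENNReal.mul_inv_cancel (by norm_num) (by norm_num), one_pow]
  have hle : ∀ ω, ∑ ε, (A ε).indicator (fun _ => H ε) ω ≤ F ω := by
    intro ω
    by_cases hω : ∃ ε, ω ∈ A ε
    · obtain ⟨ε, hε⟩ := hω
      have hε' : ∀ j, r j ω = ((ε j : ℤ) : ℝ) := fun j => Set.mem_iInter.1 hε j
      rw [Finset.sum_eq_single ε]
      · rw [Set.indicator_of_mem hε]; exact hHF ε ω hε'
      · intro ε' _ hne
        refine Set.indicator_of_notMem (fun hmem => hne ?_) _
        ext j
        have h2 : r j ω = ((ε' j : ℤ) : ℝ) := Set.mem_iInter.1 hmem j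
        rw [hε' j] at h2
        exact_mod_cast h2.symm
      · simp
    · rw [Finset.sum_eq_zero]
      · exact zero_le
      · exact fun ε _ => Set.indicator_of_notMem (fun hmem => hω ⟨ε, hmem⟩) _
  calc ∑ ε, H ε = ∑ ε, Fintype.card (ι → ℤˣ) * ∫⁻ ω, (A ε).indicator (fun _ => H ε) ω ∂P := by
        refine Finset.sum_congr rfl fun ε _ => ?_
        rw [lintegral_indicator_const (hAm ε), mul_left_comm, hPA, mul_one]
    _ = Fintype.card (ι → ℤˣ) * ∫⁻ ω, ∑ ε, (A ε).indicator (fun _ => H ε) ω ∂P := by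
        rw [lintegral_finsetSum _ fun ε _ => measurable_const.indicator (hAm ε), Finset.mul_sum]
    _ ≤ _ := by gcongr with ω; exact hle ω

/-- The two atoms already exhaust the mass: a probability measure dominated by another one equals
it. -/
lemma map_eq_half_dirac_add [IsProbabilityMeasure P] {X : Ω' → ℝ} (hX : Measurable X)
    (h1 : P {ω | X ω = 1} = 1 / 2) (h2 : P {ω | X ω = -1} = 1 / 2) :
    P.map X = (1 / 2 : ℝ≥0∞) • Measure.dirac 1 + (1 / 2 : ℝ≥0∞) • Measure.dirac (-1) := by
  have : IsProbabilityMeasure (P.map X) := Measure.isProbabilityMeasure_map hX.aemeasurable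
  have : IsProbabilityMeasure
      ((1 / 2 : ℝ≥0∞) • Measure.dirac (1 : ℝ) + (1 / 2 : ℝ≥0∞) • Measure.dirac (-1)) :=
    ⟨by simp [ENNReal.inv_two_add_inv_two]⟩
  refine (Measure.eq_of_le_of_isProbabilityMeasure (Measure.le_iff.2 fun s hs => ?_)).symm
  have e1 : (P.map X) {1} = 1 / 2 := by
    rw [Measure.map_apply hX (measurableSet_singleton _)]; exact h1
  have e2 : (P.map X) {-1} = 1 / 2 := by
    rw [Measure.map_apply hX (measurableSet_singleton _)]; exact h2
  simp only [Measure.add_apply, Measure.smul_apply, Measure.dirac_apply' _ hs, smul_eq_mul]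
  by_cases p1 : (1 : ℝ) ∈ s <;> by_cases p2 : (-1 : ℝ) ∈ s
  · simp only [p1, p2, Set.indicator_of_mem, Pi.one_apply, mul_one]
    rw [← e1]
    nth_rewrite 2 [e1]
    rw [← e2, ← measure_union (by norm_num) (measurableSet_singleton _)]
    exact measure_mono (Set.union_subset (by simpa using p1) (by simpa using p2))
  · simp only [p1, p2, Set.indicator_of_mem, not_false_eq_true, Set.indicator_of_notMem,
      Pi.one_apply, mul_one, mul_zero, add_zero]
    rw [← e1]; exact measure_mono (by simpa using p1)
  · simp only [p1, p2, Set.indicator_of_mem, not_false_eq_true, Set.indicator_of_notMem,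
      Pi.one_apply, mul_one, mul_zero, zero_add]
    rw [← e2]; exact measure_mono (by simpa using p2)
  · simp [p1, p2]

/-- The law of a Rademacher sequence is invariant under sign changes of coordinates. -/
lemma IsRademacherFamily.map_sign_mul_eq [IsProbabilityMeasure P] {ι : Type*} {ρ : ι → Ω' → ℝ}
    (h : IsRademacherFamily ρ P) (σ : ι → ℤˣ) :
    P.map (fun ω k => ((σ k : ℤ) : ℝ) * ρ k ω) = P.map (fun ω k => ρ k ω) := by
  have hm : ∀ k, Measurable fun ω => ((σ k : ℤ) : ℝ) * ρ k ω := fun k => (h.1 k).const_mul _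
  have hind : iIndepFun (fun k ω => ((σ k : ℤ) : ℝ) * ρ k ω) P :=
    h.2.2.comp (fun k y => ((σ k : ℤ) : ℝ) * y) fun k => measurable_const_mul _
  rw [hind.map_fun_eq_infinitePi_map hm, h.2.2.map_fun_eq_infinitePi_map h.1]
  congr 1
  ext1 k
  rw [map_eq_half_dirac_add (h.1 k) (h.2.1 k).1 (h.2.1 k).2]
  have key : ∀ c : ℝ, {ω | ((σ k : ℤ) : ℝ) * ρ k ω = c} =
      ρ k ⁻¹' {((σ k : ℤ) : ℝ) * c} := by
    intro c
    ext ω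
    rcases Int.units_eq_one_or (σ k) with hσ | hσ
    · simp [hσ]
    · simp [hσ, neg_eq_iff_eq_neg]
  refine map_eq_half_dirac_add (hm k) ?_ ?_
  · rw [key, mul_one]
    exact h.measure_eq_sign k (σ k)
  · rw [key, mul_neg_one]
    simpa using h.measure_eq_sign k (-σ k)

end Rademacher

/-! ### Infinite series by symmetrization of the tail -/

section Series

variable {Ω : Type*} [MeasurableSpace Ω] {μ : Measure Ω}

/-- The essential supremum of the limit in measure of a sequence, as a functional of the
sequence. -/
noncomputable def limitNorm (μ : Measure Ω) (F : ℕ → Ω → ℂ) : ℝ≥0∞ :=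
  ⨅ (t : ℚ) (_ : Tendsto (fun n => μ {x | (t : ℝ) ≤ ‖F n x‖}) atTop (𝓝 0)),
    ENNReal.ofReal t

lemma limitNorm_le_of_tendstoInMeasure {F : ℕ → Ω → ℂ} {S : Ω → ℂ}
    (h : TendstoInMeasure μ F atTop S) : limitNorm μ F ≤ eLpNorm S ∞ μ := by
  refine le_of_forall_gt fun c hc => ?_
  obtain ⟨t, ht0, ht1, ht2⟩ := ENNReal.lt_iff_exists_rat_btwn.1 hc
  obtain ⟨s, hs0, hs1, hs2⟩ := ENNReal.lt_iff_exists_rat_btwn.1 ht1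
  have hst : (s : ℝ) < t := by
    have h1 : Real.toNNReal s < Real.toNNReal t := by exact_mod_cast hs2
    exact (Real.toNNReal_lt_toNNReal_iff'.1 h1).1
  have hae : ∀ᵐ x ∂μ, ‖S x‖ ≤ s := by
    have h2 : ∀ᵐ x ∂μ, ‖S x‖ₑ ≤ eLpNorm S ∞ μ := by
      rw [eLpNorm_exponent_top]; exact ae_le_eLpNormEssSup
    filter_upwards [h2] with x hx
    have h3 : ENNReal.ofReal ‖S x‖ ≤ ENNReal.ofReal s := by
      rw [ofReal_norm]; exact hx.trans hs1.le
    exact (ENNReal.ofReal_le_ofReal_iff (by exact_mod_cast hs0)).1 h3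
  have htend : Tendsto (fun n => μ {x | (t : ℝ) ≤ ‖F n x‖}) atTop (𝓝 0) := by
    refine tendsto_of_tendsto_of_tendsto_of_le_of_le tendsto_const_nhds
      (tendstoInMeasure_iff_norm.1 h (t - s) (by linarith)) (fun _ => zero_le) fun n => ?_
    refine measure_mono_ae ?_
    filter_upwards [hae] with x hx hxt
    have h4 : ‖F n x‖ ≤ ‖F n x - S x‖ + ‖S x‖ := by
      simpa using norm_add_le (F n x - S x) (S x)
    have h5 : (t : ℝ) ≤ ‖F n x‖ := hxt
    show (t : ℝ) - s ≤ ‖F n x - S x‖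
    linarith
  exact (iInf₂_le t htend).trans_lt ht2

/-- Where `2 ‖H‖` exceeds `t + t'`, either `‖F m‖ ≥ t` or `‖G m‖ ≥ t'`. The measures of these two
sets tend to zero, while the set for `H` does not depend on `m`. -/
lemma two_mul_eLpNorm_top_le_limitNorm_add {F G : ℕ → Ω → ℂ} {H : Ω → ℂ} {n : ℕ}
    (h : ∀ m, n ≤ m → ∀ x, F m x + G m x = 2 * H x) :
    2 * eLpNorm H ∞ μ ≤ limitNorm μ F + limitNorm μ G := by
  simp only [limitNorm, ENNReal.iInf_add, ENNReal.add_iInf]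
  refine le_iInf₂ fun t ht => le_iInf₂ fun t' ht' => ?_
  have hzero : μ {x | ((t + t' : ℚ) : ℝ) < 2 * ‖H x‖} = 0 := by
    have hsum := ht.add ht'
    rw [add_zero] at hsum
    refine le_antisymm (ge_of_tendsto hsum ?_) zero_le
    filter_upwards [eventually_ge_atTop n] with m hm
    refine (measure_mono fun x hx => ?_).trans (measure_union_le _ _)
    by_contra hnot
    simp only [Set.mem_union, Set.mem_ofPred_eq, not_or, not_le] at hnot hx
    have h1 : ‖(2 : ℂ) * H x‖ ≤ ‖F m x‖ + ‖G m x‖ := by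
      rw [← h m hm x]; exact norm_add_le _ _
    rw [norm_mul, Complex.norm_ofNat] at h1
    push_cast at hx
    linarith
  have hae : ∀ᵐ x ∂μ, ‖((2 : ℂ) • H) x‖ₑ ≤ ENNReal.ofReal t + ENNReal.ofReal t' := by
    have : ∀ᵐ x ∂μ, ¬ ((t + t' : ℚ) : ℝ) < 2 * ‖H x‖ := by
      rw [ae_iff]; simpa using hzero
    filter_upwards [this] with x hx
    rw [← ofReal_norm]
    refine le_trans (ENNReal.ofReal_le_ofReal ?_) ENNReal.ofReal_add_le
    rw [Pi.smul_apply, norm_smul, Complex.norm_ofNat]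
    push_cast at hx
    linarith
  have h2 : eLpNorm ((2 : ℂ) • H) ∞ μ ≤ ENNReal.ofReal t + ENNReal.ofReal t' := by
    rw [eLpNorm_exponent_top]; exact eLpNormEssSup_le_of_ae_enorm_bound hae
  rw [eLpNorm_const_smul] at h2
  have h3 : ‖(2 : ℂ)‖ₑ = 2 := by
    rw [← ofReal_norm, Complex.norm_ofNat]; simp
  rw [h3] at h2
  rwa [add_comm (ENNReal.ofReal t) _] at h2

/-- The sum `S ω` need not depend measurably on `ω`, so the change of signs is carried out on this
functional of the coefficient sequence instead. Rational levels keep the infimum countable. -/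
lemma measurable_limitNorm [SFinite μ] {Y : Type*} [MeasurableSpace Y] {F : ℕ → Y → Ω → ℂ}
    (hF : ∀ n, Measurable fun p : Y × Ω => F n p.1 p.2) :
    Measurable fun y => limitNorm μ fun n => F n y := by
  classical
  have h : ∀ t : ℚ, Measurable fun y =>
      ⨅ (_ : Tendsto (fun n => μ {x | (t : ℝ) ≤ ‖F n y x‖}) atTop (𝓝 0)), ENNReal.ofReal t := by
    intro t
    have hset : MeasurableSet {y | Tendsto (fun n => μ {x | (t : ℝ) ≤ ‖F n y x‖}) atTop (𝓝 0)} := by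
      refine measurableSet_tendsto (𝓝 0) fun n => ?_
      exact measurable_measure_prodMk_left
        (s := {p : Y × Ω | (t : ℝ) ≤ ‖F n p.1 p.2‖})
        (measurableSet_le measurable_const (hF n).norm)
    have : (fun y => ⨅ (_ : Tendsto (fun n => μ {x | (t : ℝ) ≤ ‖F n y x‖}) atTop (𝓝 0)),
        ENNReal.ofReal t) = fun y =>
        if Tendsto (fun n => μ {x | (t : ℝ) ≤ ‖F n y x‖}) atTop (𝓝 0)
        then ENNReal.ofReal t else ⊤ := by
      ext y; split_ifs with hy <;> simp [hy]
    rw [this]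
    exact Measurable.ite hset measurable_const measurable_const
  exact Measurable.iInf h

variable {Ω' : Type*} [MeasurableSpace Ω'] {P : Measure Ω'} [IsProbabilityMeasure P]

/-- Partial sums of a random series are dominated, on average, by the limit in measure. -/
lemma lintegral_partialSum_le [IsProbabilityMeasure μ] {v : ℕ → Ω → ℂ} (hv : ∀ k, Measurable (v k))
    {ρ : ℕ → Ω' → ℝ} (hρ : IsRademacherFamily ρ P) {S : Ω' → Ω → ℂ}
    (hS : ∀ᵐ ω ∂P, TendstoInMeasure μ
      (fun (n : ℕ) x => ∑ k ∈ Finset.range n, (ρ k ω : ℂ) * v k x) atTop (S ω)) (n : ℕ) :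
    ∫⁻ ω, eLpNorm (fun x => ∑ k ∈ Finset.range n, (ρ k ω : ℂ) * v k x) ∞ μ ∂P ≤
      ∫⁻ ω, eLpNorm (S ω) ∞ μ ∂P := by
  let F : ℕ → (ℕ → ℝ) → Ω → ℂ := fun m y x => ∑ k ∈ Finset.range m, (y k : ℂ) * v k x
  -- Adding the series with its tail from `n` on negated leaves twice the `n`-th partial sum, and
  -- the negated series has the same law.
  let σ : ℕ → ℤˣ := fun k => if k < n then 1 else -1
  have hF : ∀ m, Measurable fun p : (ℕ → ℝ) × Ω => F m p.1 p.2 := fun m =>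
    Finset.measurable_sum _ fun k _ => (Complex.measurable_ofReal.comp
      ((measurable_pi_apply k).comp measurable_fst)).mul ((hv k).comp measurable_snd)
  have hG : Measurable fun y => limitNorm μ fun m => F m y := measurable_limitNorm hF
  have hρm : Measurable fun ω k => ρ k ω := measurable_pi_iff.2 hρ.1
  have hσm : Measurable fun ω k => ((σ k : ℤ) : ℝ) * ρ k ω :=
    measurable_pi_iff.2 fun k => (hρ.1 k).const_mul _
  have hflip : ∫⁻ ω, limitNorm μ (fun m => F m fun k => ((σ k : ℤ) : ℝ) * ρ k ω) ∂P =
      ∫⁻ ω, limitNorm μ (fun m => F m fun k => ρ k ω) ∂P := by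
    rw [← lintegral_map hG hσm, hρ.map_sign_mul_eq σ, lintegral_map hG hρm]
  have hpt : ∀ y : ℕ → ℝ, 2 * eLpNorm (F n y) ∞ μ ≤
      limitNorm μ (fun m => F m y) + limitNorm μ (fun m => F m fun k => ((σ k : ℤ) : ℝ) * y k) := by
    intro y
    refine two_mul_eLpNorm_top_le_limitNorm_add (n := n) fun m hm x => ?_
    simp only [F]
    rw [← Finset.sum_add_distrib, ← Finset.sum_range_add_sum_Ico _ hm, Finset.mul_sum]
    rw [Finset.sum_eq_zero (s := Finset.Ico n m), add_zero]
    · refine Finset.sum_congr rfl fun k hk => ?_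
      simp [σ, Finset.mem_range.1 hk]; ring
    · intro k hk
      simp [σ, not_lt.2 (Finset.mem_Ico.1 hk).1]
  have hle : 2 * ∫⁻ ω, eLpNorm (F n fun k => ρ k ω) ∞ μ ∂P ≤
      2 * ∫⁻ ω, limitNorm μ (fun m => F m fun k => ρ k ω) ∂P := by
    calc _ = ∫⁻ ω, 2 * eLpNorm (F n fun k => ρ k ω) ∞ μ ∂P :=
          (lintegral_const_mul' _ _ (by simp)).symm
      _ ≤ ∫⁻ ω, (limitNorm μ (fun m => F m fun k => ρ k ω) +
            limitNorm μ (fun m => F m fun k => ((σ k : ℤ) : ℝ) * ρ k ω)) ∂P :=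
          lintegral_mono fun ω => hpt _
      _ = _ := by
          have hm : Measurable fun ω => limitNorm μ fun m => F m fun k => ρ k ω := hG.comp hρm
          rw [lintegral_add_left hm, hflip, two_mul]
  rw [ENNReal.mul_le_mul_iff_right (by simp) (by simp)] at hle
  refine hle.trans (lintegral_mono_ae ?_)
  filter_upwards [hS] with ω hω
  exact limitNorm_le_of_tendstoInMeasure hω

end Series

/-! ### Measurable representatives and the theorem -/

lemma orliczNorm_congr_ae {Ω : Type*} [MeasurableSpace Ω] {μ : Measure Ω} {Φ : ℝ → ℝ}
    {F G : Ω → ℂ} (h : F =ᵐ[μ] G) : orliczNorm Φ F μ = orliczNorm Φ G μ := by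
  have : ∀ t : ℝ, ∫⁻ x, ENNReal.ofReal (Φ (‖F x‖ / t)) ∂μ =
      ∫⁻ x, ENNReal.ofReal (Φ (‖G x‖ / t)) ∂μ := fun t =>
    lintegral_congr_ae (h.mono fun x hx => by simp only [hx])
  simp only [orliczNorm, this]

lemma sum_mul_ae_eq {Ω ι : Type*} [MeasurableSpace Ω] {μ : Measure Ω} {φ φ' : ι → Ω → ℂ}
    (h : ∀ j, φ j =ᵐ[μ] φ' j) (s : Finset ι) (c : ι → ℂ) :
    (fun x => ∑ j ∈ s, c j * φ j x) =ᵐ[μ] fun x => ∑ j ∈ s, c j * φ' j x := by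
  have h1 : ∀ᵐ x ∂μ, ∀ j ∈ s, φ j x = φ' j x := (Finset.eventually_all s).2 fun j _ => h j
  filter_upwards [h1] with x hx
  exact Finset.sum_congr rfl fun j hj => by rw [hx j hj]

lemma IsRademacherSidon.congr_ae {Ω Ω' ι : Type*} [MeasurableSpace Ω] [MeasurableSpace Ω']
    {μ : Measure Ω} {P : Measure Ω'} {γ : ℝ} {φ φ' : ι → Ω → ℂ} {r : ι → Ω' → ℝ}
    (h : ∀ j, φ j =ᵐ[μ] φ' j) (hφ : IsRademacherSidon γ φ μ r P) :
    IsRademacherSidon γ φ' μ r P := by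
  refine ⟨fun s a => (hφ.1 s a).trans (le_of_eq ?_), fun e a S hS => hφ.2 e a S ?_⟩
  · exact lintegral_congr fun ω => eLpNorm_congr_ae (sum_mul_ae_eq h s _)
  · filter_upwards [hS] with ω hω
    exact hω.congr_left fun n =>
      (sum_mul_ae_eq (fun k => h (e k)) (Finset.range n) fun k => (r (e k) ω : ℂ) * a (e k)).symm

lemma PsiTwoCondition.precomp {Ω ι κ : Type*} [MeasurableSpace Ω] {μ : Measure Ω} {C : ℝ}
    {φ : ι → Ω → ℂ} (h : PsiTwoCondition C φ μ) (g : κ ↪ ι) :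
    PsiTwoCondition C (fun k => φ (g k)) μ := by
  intro s a
  have h1 := h (s.map g) (Function.extend g a 0)
  simpa only [Finset.sum_map, g.injective.extend_apply] using h1

theorem mainTheorem4 (C : ℝ) :
    ∃ γ : ℝ, 0 < γ ∧
      ∀ (ι : Type*) (Ω : Type*) [MeasurableSpace Ω] (μ : Measure Ω) [IsProbabilityMeasure μ]
        (φ : ι → Ω → ℂ),
        (∀ j, AEStronglyMeasurable (φ j) μ) →
        (∀ j, eLpNorm (φ j) 2 μ = 1) →
        PsiTwoCondition C φ μ →
        ∀ (Ω' : Type*) [MeasurableSpace Ω'] (P : Measure Ω') [IsProbabilityMeasure P]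
          (r : ι → Ω' → ℝ),
          IsRademacherFamily r P →
          IsRademacherSidon γ φ μ r P := by
  classical
  obtain ⟨γ, hγ, hmain⟩ := exists_mul_sum_enorm_le_signNormSum C
  refine ⟨γ, hγ, ?_⟩
  intro ι Ω _ μ _ φ₀ hφ₀ h2₀ hψ₀ Ω' _ P _ r hr
  set φ : ι → Ω → ℂ := fun j => (hφ₀ j).mk (φ₀ j) with hφdef
  have hae : ∀ j, φ j =ᵐ[μ] φ₀ j := fun j => (hφ₀ j).ae_eq_mk.symm
  have hφ : ∀ j, Measurable (φ j) := fun j => (hφ₀ j).stronglyMeasurable_mk.measurable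
  have h2 : ∀ j, eLpNorm (φ j) 2 μ = 1 := fun j => by rw [eLpNorm_congr_ae (hae j), h2₀ j]
  have hψ : PsiTwoCondition C φ μ := fun s a => by
    rw [orliczNorm_congr_ae (sum_mul_ae_eq hae s a)]; exact hψ₀ s a
  have hfin : ∀ (s : Finset ι) (a : ι → ℂ), ENNReal.ofReal γ * ∑ j ∈ s, ‖a j‖ₑ ≤
      ∫⁻ ω, eLpNorm (fun x => ∑ j ∈ s, (r j ω : ℂ) * a j * φ j x) ∞ μ ∂P := by
    intro s a
    have h3 := hmain s Ω μ (fun j => φ j) (fun j => hφ j) (fun j => h2 j)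
      (hψ.precomp (Function.Embedding.subtype (· ∈ s))) (fun j => a j)
    have h4 := (hr.precomp (g := fun j : s => (j : ι)) Subtype.val_injective).sum_le_card_mul_lintegral
      (fun ε => eLpNorm (fun x => ∑ j : s, ((ε j : ℤ) : ℂ) * a j * φ j x) ∞ μ)
      (fun ω => eLpNorm (fun x => ∑ j ∈ s, (r j ω : ℂ) * a j * φ j x) ∞ μ)
      (fun ε ω hω => by
        refine le_of_eq ?_
        congr 1
        ext x
        rw [← Finset.sum_coe_sort s fun j => (r j ω : ℂ) * a j * φ j x]
        refine Finset.sum_congr rfl fun j _ => ?_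
        rw [hω j]; push_cast; rfl)
    have h5 := h3.trans h4
    rw [ENNReal.mul_le_mul_iff_right (by exact_mod_cast Fintype.card_ne_zero) (by simp)] at h5
    rwa [Finset.sum_coe_sort s fun j => ‖a j‖ₑ] at h5
  refine IsRademacherSidon.congr_ae hae ⟨hfin, fun e a S hS => ?_⟩
  -- In `[0, ∞]` the sum is the supremum of its partial sums, each handled by the finite inequality
  -- and the domination of partial sums by the limit.
  rw [← e.tsum_eq fun j => ‖a j‖ₑ, ENNReal.tsum_eq_iSup_nat, ENNReal.mul_iSup]
  refine iSup_le fun n => ?_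
  have h3 := hfin ((Finset.range n).map e.toEmbedding) a
  simp only [Finset.sum_map, Equiv.coe_toEmbedding] at h3
  refine h3.trans ?_
  have h4 := lintegral_partialSum_le (μ := μ) (P := P) (v := fun k x => a (e k) * φ (e k) x)
    (fun k => (hφ (e k)).const_mul _) (hr.precomp e.injective) (S := S)
    (by simpa only [mul_assoc] using hS) n
  simpa only [mul_assoc] using h4
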